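/- Let $\epsilon>0$ and $K\ge 0$. There is a constant $C=C(\epsilon,K)>0$ such that the following holds. Let $f$ be any real-valued multiplicative function on the positive integers such that $0\le f(p)\le 1$ and $0\le f(p^m)\le f(p)$ for all primes $p$ and all $m\ge 2$, and suppose that for some $0<\alpha\le 1$ $$\Big|\sum_{p\le X}\frac{f(p)}{p}-\alpha\log\log X\Big|\le K\qquad\text{for all real } X\ge 2,$$ where $p$ runs over primes. Then for all real $M,N\ge 2$ and all complex sequences $(a_n)_{n\ge1}$, $(b_m)_{m\ge1}$ supported on the odd integers with $|a_n|\le 1$ and $|b_m|\le 1$, $$\Big|\sum_{1\le n\le N}\ \sum_{1\le m\le M} a_n b_m f(m)\left(\frac{n}{m}\right)\Big|\le C\left(\frac{MN^{1/2}\log N}{(\log M)^{1-\alpha}}+\frac{M^{1/2+\epsilon}N^{3/2}(\log N)^{1/2}}{(\log M)^{(1-\alpha)/2}}\right),$$ where $\left(\frac{n}{m}\right)$ is the Jacobi symbol. -/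

import Mathlib

open Finset NumberTheorySymbols

/-- The truncated Mertens sum `∑_{p ≤ X} f(p)/p`, over primes `p`. -/
noncomputable def primeSum (f : ArithmeticFunction ℝ) (X : ℝ) : ℝ :=
  ∑ p ∈ (Finset.Icc 1 ⌊X⌋₊).filter Nat.Prime, f p / p

/-- The bilinear sum `∑_{1 ≤ n ≤ N} ∑_{1 ≤ m ≤ M} a_n b_m f(m) (n/m)`, with `(n/m)` the Jacobi
symbol. It is used for sequences `b` that vanish at even integers. -/
noncomputable def bilinearJacobiSum (f : ArithmeticFunction ℝ) (a b : ℕ → ℂ) (N M : ℝ) : ℂ :=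
  ∑ n ∈ Finset.Icc 1 ⌊N⌋₊, ∑ m ∈ Finset.Icc 1 ⌊M⌋₊,
    a n * b m * (f m : ℂ) * ((J((n : ℤ) | m) : ℤ) : ℂ)

/-! The function `f` is too irregular to sum against a character, so it is first replaced by a sieve
majorant `F m = ∑ w d` over the `d ∣ m` in a finite set `𝒟`, with `|w d| ≤ 1` and `d ≤ D = M ^ (4 *
δ)`. This Brun–Hooley majorant (`exists_sieve_majorant`) has mean value of the right order: `∑ F m ≪
M / (log M) ^ (1 - α)` for `m ≤ M`, by the hypothesis on `primeSum` and Mertens' theorem.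

Cauchy–Schwarz in `m` with weight `F` removes `b`, and opening the square leaves sums of `F m * J(n₁
n₂ | m)` over odd `m` (`norm_sum_sum_jacobiSym_sq_le`). If `n₁ n₂` is a square, the sum is bounded
by `∑ F m`; there are `≪ N log N` such pairs (`card_pairs_isSquare_le`). Otherwise `m ↦ J(n₁ n₂ |
m)` on odd `m` is a nontrivial character modulo `4 n₁ n₂`, and Pólya–Vinogradov, applied for each `d
∈ 𝒟`, gives `≪ D N log N`. Multiplying by `∑ F m` and taking square roots yields the two terms. -/

/-! ### Gauss sums and the Pólya–Vinogradov inequality. -/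

theorem DirichletCharacter.IsPrimitive.norm_gaussSum_sq {q : ℕ} [NeZero q]
    {χ : DirichletCharacter ℂ q} (hχ : χ.IsPrimitive) :
    ‖gaussSum χ (ZMod.stdAddChar (N := q))‖ ^ 2 = q := by
  set e := ZMod.stdAddChar (N := q)
  have h1 : gaussSum χ e * star (gaussSum χ e) = q := by
    rw [star_gaussSum_eq]
    calc gaussSum χ e * gaussSum χ⁻¹ e⁻¹
        = ∑ a, (χ⁻¹ a * gaussSum χ e) * e (-a) := by
          rw [gaussSum, gaussSum, mul_comm, Finset.sum_mul]
          exact Finset.sum_congr rfl fun a _ => by rw [AddChar.inv_apply]; ring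
      _ = ∑ a, ∑ b, χ b * e (a * (b - 1)) := by
          refine Finset.sum_congr rfl fun a _ => ?_
          -- Primitivity is what makes the twisting identity valid at every `a`, including
          -- non-units.
          rw [← gaussSum_mulShift_of_isPrimitive e hχ a, gaussSum, Finset.sum_mul]
          refine Finset.sum_congr rfl fun b _ => ?_
          rw [AddChar.mulShift_apply, mul_assoc, ← AddChar.map_add_eq_mul]
          ring_nf
      _ = ∑ b, χ b * ∑ a, e (a * (b - 1)) := by
          rw [Finset.sum_comm]
          exact Finset.sum_congr rfl fun b _ => by rw [Finset.mul_sum]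
      _ = ∑ b, χ b * (if b - 1 = 0 then (Fintype.card (ZMod q) : ℂ) else 0) :=
          Finset.sum_congr rfl fun b _ => by
            rw [AddChar.sum_mulShift (b - 1) (ZMod.isPrimitive_stdAddChar q)]
            simp
      _ = q := by simp [sub_eq_zero, ZMod.card]
  have h2 := congrArg norm h1
  rw [norm_mul, norm_star, Complex.norm_natCast] at h2
  rw [sq, h2]

theorem norm_geom_sum_le {z : ℂ} (hz : ‖z‖ = 1) (X : ℕ) :
    ‖z - 1‖ * ‖∑ m ∈ range X, z ^ m‖ ≤ 2 := by
  rw [← norm_mul, mul_comm, geom_sum_mul]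
  refine (norm_sub_le _ _).trans ?_
  simp [hz]; norm_num

/-- A geometric series with ratio `z`, where `‖z - 1‖ = 2 |sin (π a / q)|`. Jordan's inequality
applies to whichever of `a`, `q - a` is at most `q / 2`; keeping both terms avoids a case split when
summing over `a`. -/
theorem norm_sum_stdAddChar_le {q : ℕ} [NeZero q] {a : ℕ} (ha : 0 < a) (haq : a < q) (X : ℕ) :
    ‖∑ m ∈ range X, ZMod.stdAddChar ((a : ZMod q) * (m : ZMod q))‖
      ≤ q / (2 * a) + q / (2 * (q - a : ℕ)) := by
  set z : ℂ := Complex.exp ((2 * Real.pi * a / q : ℝ) * Complex.I) with hz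
  have hq : (0 : ℝ) < q := by exact_mod_cast ha.trans haq
  have ha' : (0 : ℝ) < a := by exact_mod_cast ha
  have hqa : (0 : ℝ) < (q - a : ℕ) := by exact_mod_cast Nat.sub_pos_of_lt haq
  have hsum : ∑ m ∈ range X, ZMod.stdAddChar ((a : ZMod q) * (m : ZMod q))
      = ∑ m ∈ range X, z ^ m := by
    refine Finset.sum_congr rfl fun m _ => ?_
    rw [hz, ← Complex.exp_nat_mul]
    have := ZMod.stdAddChar_coe (N := q) ((a * m : ℕ) : ℤ)
    push_cast at this
    rw [this]
    congr 1
    push_cast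
    ring
  have hnorm : ‖z‖ = 1 := Complex.norm_exp_ofReal_mul_I _
  have hgeom := norm_geom_sum_le hnorm X
  have hz1 : ‖z - 1‖ = ‖2 * Real.sin (Real.pi * a / q)‖ := by
    have := Complex.norm_exp_I_mul_ofReal_sub_one (2 * Real.pi * a / q)
    rw [mul_comm] at this
    rw [hz, this]
    congr 3
    ring
  rw [hsum]
  set G := ‖∑ m ∈ range X, z ^ m‖
  have hG : 0 ≤ G := norm_nonneg _
  have key : ∀ b : ℝ, 0 < b → b ≤ q / 2 → Real.sin (Real.pi * b / q) ≤ ‖z - 1‖ / 2 →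
      G ≤ q / (2 * b) := by
    intro b hb hbq hs
    have h1 : 2 / Real.pi * (Real.pi * b / q) ≤ Real.sin (Real.pi * b / q) := by
      refine Real.mul_le_sin (by positivity) ?_
      rw [div_le_iff₀ hq]
      nlinarith [Real.pi_pos]
    have h2 : 2 / Real.pi * (Real.pi * b / q) = 2 * b / q := by
      field_simp
    rw [h2] at h1
    have h3 : 4 * b / q ≤ ‖z - 1‖ := by
      have : 4 * b / q = 2 * (2 * b / q) := by ring
      linarith
    have h4 : 4 * b / q * G ≤ 2 := (mul_le_mul_of_nonneg_right h3 hG).trans hgeom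
    rw [le_div_iff₀ (by positivity)]
    rw [div_mul_eq_mul_div, div_le_iff₀ hq] at h4
    linarith
  have hsin : Real.sin (Real.pi * a / q) ≤ ‖z - 1‖ / 2 := by
    rw [hz1, Real.norm_eq_abs, abs_mul, abs_two]
    linarith [le_abs_self (Real.sin (Real.pi * a / q))]
  rcases le_total (a : ℝ) (q / 2) with h | h
  · exact (key a ha' h hsin).trans (le_add_of_nonneg_right (by positivity))
  · have hc : ((q - a : ℕ) : ℝ) = q - a := by rw [Nat.cast_sub haq.le]
    have hs2 : Real.sin (Real.pi * (q - a : ℕ) / q) = Real.sin (Real.pi * a / q) := by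
      rw [← Real.sin_pi_sub, hc]
      congr 1
      field_simp
      ring
    exact (key _ hqa (by rw [hc]; linarith) (hs2 ▸ hsin)).trans
      (le_add_of_nonneg_left (by positivity))

theorem sum_inv_Icc_le (n : ℕ) : ∑ i ∈ Icc 1 n, (i : ℝ)⁻¹ ≤ 1 + Real.log n := by
  have := harmonic_le_one_add_log n
  rw [harmonic_eq_sum_Icc] at this
  push_cast at this
  exact this

/-- The Pólya–Vinogradov inequality for primitive characters. -/
theorem DirichletCharacter.IsPrimitive.norm_sum_le {q : ℕ} (hq : 2 ≤ q)
    {χ : DirichletCharacter ℂ q} (hχ : χ.IsPrimitive) (X : ℕ) :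
    ‖∑ m ∈ Icc 1 X, χ (m : ZMod q)‖ ≤ √q * (1 + Real.log q) := by
  have : NeZero q := ⟨by lia⟩
  have hq0 : (0 : ℝ) < q := by exact_mod_cast (by lia : 0 < q)
  set e := ZMod.stdAddChar (N := q)
  set τ := gaussSum χ e
  have hτ : ‖τ‖ = √q := by
    rw [← hχ.norm_gaussSum_sq, Real.sqrt_sq (norm_nonneg _)]
  have hrange : ∑ m ∈ Icc 1 X, χ⁻¹ (m : ZMod q) = ∑ m ∈ range (X + 1), χ⁻¹ (m : ZMod q) := by
    rw [Finset.range_eq_Ico, Finset.sum_eq_sum_Ico_succ_bot (Nat.succ_pos _)]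
    rw [Nat.cast_zero, DirichletCharacter.map_zero' _ (by lia), zero_add]
    rfl
  -- Multiplying by `τ` expands the character into additive characters, leaving geometric sums in
  -- `m`. Passing to `χ⁻¹` is harmless: it is the conjugate of `χ`.
  have hsum : (∑ m ∈ Icc 1 X, χ⁻¹ (m : ZMod q)) * τ =
      ∑ b : ZMod q, χ b * ∑ m ∈ range (X + 1), e (b * (m : ZMod q)) := by
    rw [hrange, Finset.sum_mul]
    calc _ = ∑ m ∈ range (X + 1), ∑ b : ZMod q, χ b * e (b * (m : ZMod q)) := by
            refine Finset.sum_congr rfl fun m _ => ?_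
            rw [← gaussSum_mulShift_of_isPrimitive e hχ, gaussSum]
            exact Finset.sum_congr rfl fun b _ => by rw [AddChar.mulShift_apply, mul_comm b]
      _ = _ := by
            rw [Finset.sum_comm]
            exact Finset.sum_congr rfl fun b _ => by rw [Finset.mul_sum]
  have hbound : ‖∑ b : ZMod q, χ b * ∑ m ∈ range (X + 1), e (b * (m : ZMod q))‖
      ≤ q * (1 + Real.log q) := by
    have h1 : ∑ b : ZMod q, χ b * ∑ m ∈ range (X + 1), e (b * (m : ZMod q)) =
        ∑ a ∈ range q, χ (a : ZMod q) * ∑ m ∈ range (X + 1), e ((a : ZMod q) * (m : ZMod q)) := by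
      symm
      refine Finset.sum_bij (fun a _ => (a : ZMod q)) (fun _ _ => mem_univ _) ?_ ?_
        (fun _ _ => rfl)
      · intro a ha b hb hab
        have := (ZMod.natCast_eq_natCast_iff a b q).1 hab
        exact Nat.ModEq.eq_of_lt_of_lt this (mem_range.1 ha) (mem_range.1 hb)
      · intro b _
        exact ⟨b.val, mem_range.2 (ZMod.val_lt b), by simp⟩
    rw [h1, Finset.range_eq_Ico, Finset.sum_eq_sum_Ico_succ_bot (by lia), Nat.cast_zero,
      DirichletCharacter.map_zero' _ (by lia), zero_mul, zero_add]
    refine (norm_sum_le_of_le (f := fun a : ℕ => χ (a : ZMod q) *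
      ∑ m ∈ range (X + 1), e ((a : ZMod q) * (m : ZMod q)))
      (n := fun a : ℕ => (q : ℝ) / (2 * a) + q / (2 * (q - a : ℕ))) _ ?_).trans ?_
    · intro a ha
      rw [Finset.mem_Ico] at ha
      rw [norm_mul]
      refine (mul_le_of_le_one_left (norm_nonneg _) (DirichletCharacter.norm_le_one χ _)).trans ?_
      exact norm_sum_stdAddChar_le (by lia) ha.2 _
    · have hrefl : ∑ a ∈ Ico 1 q, (q : ℝ) / (2 * (q - a : ℕ)) = ∑ a ∈ Ico 1 q, (q : ℝ) / (2 * a) := by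
        refine Finset.sum_nbij' (fun a => q - a) (fun a => q - a) ?_ ?_ ?_ ?_ ?_ <;>
          intro a ha <;> rw [Finset.mem_Ico] at ha
        · rw [Finset.mem_Ico]; lia
        · rw [Finset.mem_Ico]; lia
        · lia
        · lia
      rw [zero_add, Finset.sum_add_distrib, hrefl, ← two_mul, Finset.mul_sum]
      calc ∑ a ∈ Ico 1 q, 2 * ((q : ℝ) / (2 * a)) = q * ∑ a ∈ Ico 1 q, (a : ℝ)⁻¹ := by
            rw [Finset.mul_sum]
            exact Finset.sum_congr rfl fun a _ => by field_simp
        _ ≤ q * ∑ a ∈ Icc 1 q, (a : ℝ)⁻¹ := by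
            gcongr
            exact Finset.Ico_subset_Icc_self
        _ ≤ q * (1 + Real.log q) := by
            gcongr
            exact sum_inv_Icc_le q
  have hstar : ‖∑ m ∈ Icc 1 X, χ (m : ZMod q)‖ = ‖∑ m ∈ Icc 1 X, χ⁻¹ (m : ZMod q)‖ := by
    rw [← norm_star, star_sum]
    congr 1
    exact Finset.sum_congr rfl fun m _ => MulChar.star_apply' χ _
  rw [hstar]
  rw [← hsum, norm_mul, hτ] at hbound
  have hs : 0 < √(q : ℝ) := Real.sqrt_pos.2 hq0
  refine le_of_mul_le_mul_right ?_ hs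
  calc _ ≤ _ := hbound
    _ = √(q : ℝ) * √q * (1 + Real.log q) := by rw [Real.mul_self_sqrt hq0.le]
    _ = _ := by ring

theorem Nat.card_divisors_le_two_mul_sqrt (n : ℕ) : (#n.divisors : ℝ) ≤ 2 * √n := by
  have hsub : n.divisors ⊆ (Icc 1 (Nat.sqrt n)) ∪ (Icc 1 (Nat.sqrt n)).image (n / ·) := by
    intro d hd
    have hn := Nat.ne_zero_of_mem_divisors hd
    have hdn := Nat.dvd_of_mem_divisors hd
    have hd0 := Nat.pos_of_mem_divisors hd
    rw [mem_union, mem_image, mem_Icc]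
    by_cases h : d ≤ Nat.sqrt n
    · exact Or.inl ⟨hd0, h⟩
    · right
      refine ⟨n / d, ?_, Nat.div_div_self hdn hn⟩
      rw [mem_Icc]
      refine ⟨Nat.div_pos (Nat.le_of_dvd (Nat.pos_of_ne_zero hn) hdn) hd0, ?_⟩
      rw [Nat.le_sqrt]
      have h1 : n < d * d := Nat.sqrt_lt.1 (not_le.1 h)
      have h2 : n / d * d = n := Nat.div_mul_cancel hdn
      have h3 : n / d < d := by
        by_contra h4
        push Not at h4
        nlinarith
      nlinarith
  have h1 : #n.divisors ≤ 2 * Nat.sqrt n := by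
    calc #n.divisors ≤ _ := card_le_card hsub
      _ ≤ _ := card_union_le _ _
      _ ≤ #(Icc 1 (Nat.sqrt n)) + #(Icc 1 (Nat.sqrt n)) := add_le_add_right Finset.card_image_le _
      _ = _ := by rw [Nat.card_Icc]; lia
  calc (#n.divisors : ℝ) ≤ ((2 * Nat.sqrt n : ℕ) : ℝ) := by exact_mod_cast h1
    _ ≤ _ := by push_cast; gcongr; exact Real.nat_sqrt_le_real_sqrt

theorem sum_moebius_divisors_gcd (m q : ℕ) (hq : q ≠ 0) :
    ∑ d ∈ q.divisors, (if d ∣ m then (ArithmeticFunction.moebius d : ℂ) else 0)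
      = if Nat.Coprime m q then 1 else 0 := by
  rw [← Finset.sum_filter]
  have h1 : {d ∈ q.divisors | d ∣ m} = (Nat.gcd m q).divisors := by
    ext d
    simp only [mem_filter, Nat.mem_divisors, Nat.dvd_gcd_iff, ne_eq, Nat.gcd_eq_zero_iff]
    tauto
  rw [h1]
  have h2 := congrArg (fun f : ArithmeticFunction ℤ => f (Nat.gcd m q))
    ArithmeticFunction.moebius_mul_coe_zeta
  simp only [ArithmeticFunction.coe_mul_zeta_apply, ArithmeticFunction.one_apply] at h2
  rw [← Int.cast_sum, h2]
  simp [Nat.Coprime]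

theorem sum_Icc_filter_dvd {R : Type*} [AddCommMonoid R] (g : ℕ → R) {d : ℕ} (hd : 0 < d) (X : ℕ) :
    ∑ m ∈ Icc 1 X with d ∣ m, g m = ∑ k ∈ Icc 1 (X / d), g (d * k) := by
  symm
  refine Finset.sum_bij (fun k _ => d * k) ?_ ?_ ?_ (fun _ _ => rfl)
  · intro k hk
    rw [mem_Icc] at hk
    rw [mem_filter, mem_Icc]
    refine ⟨⟨Nat.mul_pos hd (by lia), ?_⟩, dvd_mul_right _ _⟩
    rw [mul_comm]
    exact (Nat.le_div_iff_mul_le hd).1 hk.2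
  · intro a _ b _ hab
    exact Nat.eq_of_mul_eq_mul_left hd hab
  · intro m hm
    rw [mem_filter, mem_Icc] at hm
    obtain ⟨⟨h1, h2⟩, k, rfl⟩ := hm
    refine ⟨k, ?_, rfl⟩
    rw [mem_Icc]
    exact ⟨Nat.pos_of_ne_zero fun h => by simp [h] at h1, (Nat.le_div_iff_mul_le hd).2 (by rw [mul_comm]; exact h2)⟩

/-- The Pólya–Vinogradov inequality for nontrivial characters. -/
theorem DirichletCharacter.norm_sum_le_of_ne_one {q : ℕ} [NeZero q]
    {χ : DirichletCharacter ℂ q} (hχ : χ ≠ 1) (X : ℕ) :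
    ‖∑ m ∈ Icc 1 X, χ (m : ZMod q)‖ ≤ 2 * √q * (1 + Real.log q) := by
  have hq : q ≠ 0 := NeZero.ne q
  set c := χ.conductor with hc
  set ψ := χ.primitiveCharacter
  have hcq : c ∣ q := χ.conductor_dvd_level
  have hc0 : c ≠ 0 := fun h => hq (by rw [h] at hcq; exact zero_dvd_iff.1 hcq)
  have hc1 : c ≠ 1 := fun h => hχ (χ.eq_one_iff_conductor_eq_one.2 h)
  have hc2 : 2 ≤ c := by lia
  have hcle : c ≤ q := Nat.le_of_dvd (Nat.pos_of_ne_zero hq) hcq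
  obtain ⟨r, hr⟩ := hcq
  -- `χ` is its primitive character `ψ` restricted to `m` coprime to `q`; Möbius inversion detects
  -- the coprimality.
  have hterm : ∀ m : ℕ, χ (m : ZMod q) = ∑ d ∈ q.divisors,
      (if d ∣ m then (ArithmeticFunction.moebius d : ℂ) else 0) * ψ (m : ZMod c) := by
    intro m
    rw [← Finset.sum_mul, sum_moebius_divisors_gcd m q hq]
    split_ifs with h
    · rw [one_mul]
      have := χ.primitiveCharacter_apply_of_isCoprime (a := (m : ℤ)) (Nat.isCoprime_iff_coprime.2 h)
      push_cast at this
      exact this.symm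
    · rw [zero_mul]
      refine MulChar.map_nonunit _ ?_
      rwa [ZMod.isUnit_iff_coprime]
  have hsum : ∑ m ∈ Icc 1 X, χ (m : ZMod q) = ∑ d ∈ q.divisors,
      (ArithmeticFunction.moebius d : ℂ) * ψ (d : ZMod c) * ∑ k ∈ Icc 1 (X / d), ψ (k : ZMod c) := by
    simp_rw [hterm]
    rw [Finset.sum_comm]
    refine Finset.sum_congr rfl fun d hd => ?_
    have hd0 := Nat.pos_of_mem_divisors hd
    simp_rw [ite_mul, zero_mul]
    rw [← Finset.sum_filter, sum_Icc_filter_dvd _ hd0, Finset.mul_sum]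
    refine Finset.sum_congr rfl fun k _ => ?_
    push_cast
    rw [map_mul, mul_assoc]
  set B := √(c : ℝ) * (1 + Real.log c)
  have hB0 : 0 ≤ B := by positivity
  have hB : ∀ d ∈ q.divisors, ‖(ArithmeticFunction.moebius d : ℂ) * ψ (d : ZMod c) *
      ∑ k ∈ Icc 1 (X / d), ψ (k : ZMod c)‖ ≤ if d ∈ r.divisors then B else 0 := by
    intro d hd
    have hdq := Nat.dvd_of_mem_divisors hd
    split_ifs with hdr
    · rw [norm_mul, norm_mul]
      have h1 : ‖(ArithmeticFunction.moebius d : ℂ)‖ ≤ 1 := by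
        rw [Complex.norm_intCast]
        exact_mod_cast ArithmeticFunction.abs_moebius_le_one
      have h2 := ψ.norm_le_one (d : ZMod c)
      have h3 := (χ.primitiveCharacter_isPrimitive).norm_sum_le hc2 (X / d)
      calc _ ≤ 1 * 1 * B := by gcongr
        _ = B := by ring
    -- A divisor of `q = c * r` not dividing `r` shares a factor with `c`, so `ψ d = 0`.
    · have : ¬ Nat.Coprime d c := fun hco => hdr (Nat.mem_divisors.2
        ⟨hco.dvd_of_dvd_mul_left (hr ▸ hdq), fun h => hq (by rw [hr, h, mul_zero])⟩)
      rw [MulChar.map_nonunit ψ (by rwa [ZMod.isUnit_iff_coprime])]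
      simp
  rw [hsum]
  refine (norm_sum_le_of_le _ hB).trans ?_
  rw [← Finset.sum_filter, Finset.sum_const, nsmul_eq_mul]
  -- The crude divisor bound costs `√r`, which exactly completes `√c` to `√q`.
  have hcard : (#{d ∈ q.divisors | d ∈ r.divisors} : ℝ) ≤ 2 * √r :=
    le_trans (by exact_mod_cast card_le_card fun d hd => (mem_filter.1 hd).2)
      (Nat.card_divisors_le_two_mul_sqrt r)
  calc _ ≤ 2 * √(r : ℝ) * (√(c : ℝ) * (1 + Real.log q)) := by
        refine mul_le_mul hcard ?_ hB0 (by positivity)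
        have : (0 : ℝ) < c := by exact_mod_cast Nat.pos_of_ne_zero hc0
        exact mul_le_mul_of_nonneg_left (by gcongr) (Real.sqrt_nonneg _)
    _ = 2 * √q * (1 + Real.log q) := by
        have : √(q : ℝ) = √c * √r := by
          rw [← Real.sqrt_mul (Nat.cast_nonneg _), ← Nat.cast_mul, ← hr]
        rw [this]; ring

/-! ### The Jacobi symbol as a nontrivial Dirichlet character. -/

theorem exists_odd_factorization_of_not_isSquare {n : ℕ} (hn : n ≠ 0) (hsq : ¬ IsSquare n) :
    ∃ p, p.Prime ∧ Odd (n.factorization p) := by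
  obtain ⟨a, b, hab, ha⟩ := Nat.sq_mul_squarefree n
  have ha0 : a ≠ 0 := fun h => hn (by rw [← hab, h, mul_zero])
  have hb0 : b ≠ 0 := fun h => hn (by rw [← hab, h]; simp)
  have ha1 : a ≠ 1 := fun h => hsq ⟨b, by rw [← hab, h, mul_one, sq]⟩
  obtain ⟨p, hp, hpa⟩ := Nat.exists_prime_and_dvd ha1
  refine ⟨p, hp, ?_⟩
  rw [← hab, Nat.factorization_mul (pow_ne_zero 2 hb0) ha0, Nat.factorization_pow]
  have h1 : a.factorization p ≤ 1 := ha.natFactorization_le_one p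
  have h2 : 0 < a.factorization p := hp.factorization_pos_of_dvd ha0 hpa
  have h3 : a.factorization p = 1 := by lia
  simp [h3]

/-- Write `n = p ^ e * n'` with `e` odd. By the Chinese remainder theorem take `m` a nonresidue
modulo `p` and `1` modulo `4 * n'`; reciprocity turns the symbol into `J(m | p) ^ e * J(m | n') =
-1`. -/
theorem exists_jacobiSym_eq_neg_one {n : ℕ} (hodd : Odd n) (hsq : ¬ IsSquare n) :
    ∃ m : ℕ, Odd m ∧ J((n : ℤ) | m) = -1 := by
  have hn : n ≠ 0 := fun h => by simp [h] at hodd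
  obtain ⟨p, hp, hpe⟩ := exists_odd_factorization_of_not_isSquare hn hsq
  have : Fact p.Prime := ⟨hp⟩
  set e := n.factorization p
  set n' := n / p ^ e with hn'
  have hnn : p ^ e * n' = n := Nat.ordProj_mul_ordCompl_eq_self n p
  have hn'0 : n' ≠ 0 := fun h => hn (by rw [← hnn, h, mul_zero])
  have hpn : p ∣ n := by
    rw [← hnn]
    exact (dvd_pow_self p (fun h => by simp [h] at hpe)).mul_right _
  have hp2 : p ≠ 2 := by
    rintro rfl
    exact (Nat.not_even_iff_odd.2 hodd) (even_iff_two_dvd.2 hpn)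
  have hco : Nat.Coprime p (4 * n') := by
    refine Nat.Coprime.mul_right ?_ (Nat.coprime_ordCompl hp hn)
    exact Nat.Coprime.pow_right 2 ((Nat.coprime_primes hp Nat.prime_two).2 hp2)
  obtain ⟨a, ha⟩ := quadraticChar_exists_neg_one (F := ZMod p)
    (by rwa [ZMod.ringChar_zmod_n])
  obtain ⟨m, hm1, hm2⟩ := Nat.chineseRemainder hco a.val 1
  have hm4 : m % 4 = 1 := (hm2.of_mul_right n' : m ≡ 1 [MOD 4])
  have hmn : m ≡ 1 [MOD n'] := hm2.of_mul_left 4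
  refine ⟨m, Nat.odd_iff.2 (by lia), ?_⟩
  rw [jacobiSym.quadratic_reciprocity_one_mod_four' hodd hm4, ← hnn,
    jacobiSym.mul_right' _ (pow_ne_zero _ hp.ne_zero) hn'0, jacobiSym.pow_right]
  have h1 : J((m : ℤ) | p) = -1 := by
    rw [← jacobiSym.legendreSym.to_jacobiSym, legendreSym, Int.cast_natCast, ← ha]
    congr 1
    have := (ZMod.natCast_eq_natCast_iff _ _ _).2 hm1
    simpa using this
  have h2 : J((m : ℤ) | n') = 1 := by
    rw [jacobiSym.mod_left' (a₂ := 1) (by exact_mod_cast hmn), jacobiSym.one_left]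
  rw [h1, h2, hpe.neg_one_pow, mul_one]

/-- For `n ≠ 0`, the character `m ↦ (n/m)` modulo `4n`, supported on odd `m`. -/
noncomputable def jacobiChar (n : ℕ) [NeZero n] : DirichletCharacter ℂ (4 * n) :=
  { toFun := fun a => if Odd a.val then (J((n : ℤ) | a.val) : ℂ) else 0
    map_one' := by
      have h : 1 < 4 * n := by have := NeZero.pos n; lia
      have : Fact (1 < 4 * n) := ⟨h⟩
      simp [ZMod.val_one]
    map_mul' := by
      intro a b
      have heven : Even (4 * n) := (by decide : Even 4).mul_right n
      have hpar : Odd ((a * b).val) ↔ Odd a.val ∧ Odd b.val := by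
        rw [ZMod.val_mul, ← Nat.odd_mul, Nat.odd_iff, Nat.odd_iff,
          Nat.mod_mod_of_dvd _ heven.two_dvd]
      by_cases h : Odd a.val ∧ Odd b.val
      -- For odd lower entries the symbol has period `4 * n`, a form of reciprocity.
      · rw [if_pos (hpar.2 h), if_pos h.1, if_pos h.2, ZMod.val_mul,
          ← jacobiSym.mod_right' n (h.1.mul h.2),
          jacobiSym.mul_right' _ h.1.pos.ne' h.2.pos.ne', Int.cast_mul]
      · rw [if_neg (mt hpar.1 h)]
        rw [not_and_or] at h
        rcases h with h | h <;> simp [h]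
    map_nonunit' := by
      intro a ha
      split_ifs with h
      · rw [jacobiSym.eq_zero_iff.2, Int.cast_zero]
        refine ⟨h.pos.ne', fun hco => ha ?_⟩
        rw [← ZMod.natCast_zmod_val a, ZMod.isUnit_iff_coprime]
        have h4 : Nat.Coprime a.val 4 :=
          Nat.Coprime.pow_right 2 ((Nat.coprime_two_right).2 h)
        exact h4.mul_right (Nat.Coprime.symm hco)
      · rfl }

theorem jacobiChar_natCast (n : ℕ) [NeZero n] (m : ℕ) :
    jacobiChar n (m : ZMod (4 * n)) = if Odd m then (J((n : ℤ) | m) : ℂ) else 0 := by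
  change (if Odd (m : ZMod (4 * n)).val then (J((n : ℤ) | (m : ZMod (4 * n)).val) : ℂ) else 0) = _
  have heven : Even (4 * n) := (by decide : Even 4).mul_right n
  have hpar : Odd ((m : ZMod (4 * n)).val) ↔ Odd m := by
    rw [ZMod.val_natCast, Nat.odd_iff, Nat.odd_iff, Nat.mod_mod_of_dvd _ heven.two_dvd]
  simp only [hpar]
  split_ifs with h
  · rw [ZMod.val_natCast, ← jacobiSym.mod_right' n h]
  · rfl

theorem jacobiChar_ne_one {n : ℕ} [NeZero n] (hodd : Odd n) (hsq : ¬ IsSquare n) :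
    jacobiChar n ≠ 1 := by
  obtain ⟨m, hm, hJ⟩ := exists_jacobiSym_eq_neg_one hodd hsq
  intro h
  have h1 := jacobiChar_natCast n m
  rw [if_pos hm, hJ, h] at h1
  by_cases hu : IsUnit (m : ZMod (4 * n))
  · rw [MulChar.one_apply hu] at h1
    norm_num at h1
  · rw [MulChar.map_nonunit _ hu] at h1
    norm_num at h1

/-! ### Counting the diagonal pairs. -/

/-- The number of pairs `(n₁, n₂)` in `[1, N]²` whose product is a square. -/
theorem card_pairs_isSquare_le (N : ℕ) :
    (#{x ∈ Icc 1 N ×ˢ Icc 1 N | IsSquare (x.1 * x.2)} : ℝ) ≤ N * (1 + Real.log N) := by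
  -- Dividing out the gcd `g` leaves coprime numbers with square product, hence two squares: the
  -- pair is `(g u², g v²)`. Each `g` admits at most `√(N / g)` values of `u` and of `v`, so at most
  -- `N / g` pairs.
  have hsub : {x ∈ Icc 1 N ×ˢ Icc 1 N | IsSquare (x.1 * x.2)} ⊆
      (Icc 1 N).biUnion fun g => (Icc 1 (Nat.sqrt (N / g)) ×ˢ Icc 1 (Nat.sqrt (N / g))).image
        fun u => (g * u.1 ^ 2, g * u.2 ^ 2) := by
    rintro ⟨a, b⟩ hx
    rw [mem_filter, mem_product, mem_Icc, mem_Icc] at hx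
    obtain ⟨⟨⟨ha1, haN⟩, hb1, hbN⟩, hs⟩ := hx
    simp only at ha1 haN hb1 hbN hs
    obtain ⟨g, a', b', hg, hco, rfl, rfl⟩ := Nat.exists_coprime' (Nat.gcd_pos_of_pos_left b ha1)
    have hsq : IsSquare (a' * b') := by
      obtain ⟨c, hc⟩ := hs
      have h1 : g ^ 2 * (a' * b') = c ^ 2 := by nlinarith
      have h2 : g ∣ c := (Nat.pow_dvd_pow_iff two_ne_zero).1 ⟨_, h1.symm⟩
      obtain ⟨k, rfl⟩ := h2
      refine ⟨k, ?_⟩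
      have : g ^ 2 * (a' * b') = g ^ 2 * (k * k) := by rw [h1]; ring
      exact Nat.eq_of_mul_eq_mul_left (by positivity) this
    obtain ⟨c, hc⟩ := hsq
    obtain ⟨u, rfl⟩ := exists_eq_pow_of_mul_eq_pow (Nat.isUnit_iff.2 hco) (hc.trans (sq c).symm)
    obtain ⟨v, rfl⟩ := exists_eq_pow_of_mul_eq_pow (Nat.isUnit_iff.2 hco.symm)
      ((mul_comm _ _).trans (hc.trans (sq c).symm))
    have hu : 0 < u := Nat.pos_of_ne_zero fun h => by simp [h] at ha1
    have hv : 0 < v := Nat.pos_of_ne_zero fun h => by simp [h] at hb1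
    rw [mem_biUnion]
    refine ⟨g, mem_Icc.2 ⟨hg, ?_⟩, ?_⟩
    · exact (Nat.le_mul_of_pos_left g (by positivity)).trans haN
    · rw [mem_image]
      refine ⟨(u, v), ?_, by simp [mul_comm]⟩
      rw [mem_product, mem_Icc, mem_Icc, Nat.le_sqrt', Nat.le_sqrt', Nat.le_div_iff_mul_le hg,
        Nat.le_div_iff_mul_le hg]
      exact ⟨⟨hu, haN⟩, hv, hbN⟩
  have hcard : #{x ∈ Icc 1 N ×ˢ Icc 1 N | IsSquare (x.1 * x.2)} ≤ ∑ g ∈ Icc 1 N, N / g := by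
    refine (card_le_card hsub).trans (card_biUnion_le.trans (sum_le_sum fun g _ => ?_))
    refine Finset.card_image_le.trans ?_
    rw [card_product, Nat.card_Icc, Nat.add_sub_cancel]
    exact Nat.sqrt_le _
  calc _ ≤ ((∑ g ∈ Icc 1 N, N / g : ℕ) : ℝ) := by exact_mod_cast hcard
    _ ≤ ∑ g ∈ Icc 1 N, (N : ℝ) * (g : ℝ)⁻¹ := by
        push_cast
        exact sum_le_sum fun g _ => Nat.cast_div_le
    _ ≤ N * (1 + Real.log N) := by
        rw [← mul_sum]
        gcongr
        exact sum_inv_Icc_le N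

/-! ### Mertens-type estimates. -/

theorem sum_primeFactors_log_le {m : ℕ} (hm : m ≠ 0) :
    ∑ p ∈ m.primeFactors, Real.log p ≤ Real.log m := by
  rw [← Real.log_prod (fun p hp => by exact_mod_cast (Nat.prime_of_mem_primeFactors hp).ne_zero),
    ← Nat.cast_prod]
  have h0 : 0 < ∏ p ∈ m.primeFactors, p :=
    prod_pos fun p hp => (Nat.prime_of_mem_primeFactors hp).pos
  exact Real.log_le_log (by exact_mod_cast h0)
    (by exact_mod_cast Nat.le_of_dvd (Nat.pos_of_ne_zero hm) m.prod_primeFactors_dvd)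

/-- The upper bound in Mertens' first theorem. -/
theorem sum_primesLE_log_div_le (n : ℕ) (hn : n ≠ 0) :
    ∑ p ∈ Nat.primesLE n, Real.log p / p ≤ Real.log n + Real.log 4 := by
  have hn0 : (0 : ℝ) < n := by exact_mod_cast Nat.pos_of_ne_zero hn
  have h1 : ∑ p ∈ Nat.primesLE n, ((n / p : ℕ) : ℝ) * Real.log p ≤ n * Real.log n := by
    calc ∑ p ∈ Nat.primesLE n, ((n / p : ℕ) : ℝ) * Real.log p
        = ∑ p ∈ Nat.primesLE n, ∑ m ∈ Icc 1 n, if p ∣ m then Real.log p else 0 := by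
          refine sum_congr rfl fun p hp => ?_
          rw [← sum_filter, sum_Icc_filter_dvd _ (Nat.prime_of_mem_primesLE hp).pos]
          simp
      _ = ∑ m ∈ Icc 1 n, ∑ p ∈ m.primeFactors, Real.log p := by
          rw [sum_comm]
          refine sum_congr rfl fun m hm => ?_
          rw [mem_Icc] at hm
          rw [← sum_filter]
          congr 1
          ext p
          rw [mem_filter, Nat.mem_primesLE, Nat.mem_primeFactors]
          exact ⟨fun h => ⟨h.1.2, h.2, by lia⟩,
            fun h => ⟨⟨(Nat.le_of_dvd (by lia) h.2.1).trans hm.2, h.1⟩, h.2.1⟩⟩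
      _ ≤ ∑ m ∈ Icc 1 n, Real.log n := by
          refine sum_le_sum fun m hm => ?_
          rw [mem_Icc] at hm
          have : (0 : ℝ) < m := by exact_mod_cast hm.1
          exact (sum_primeFactors_log_le (by lia)).trans
            (Real.log_le_log this (by exact_mod_cast hm.2))
      _ = n * Real.log n := by simp
  -- Chebyshev's bound pays for replacing `n / p` by its floor.
  have h2 : ∑ p ∈ Nat.primesLE n, Real.log p ≤ Real.log 4 * n := by
    rw [← Chebyshev.theta_eq_sum_primesLE_log]
    exact Chebyshev.theta_le_log4_mul_x hn0.le
  have h3 : n * ∑ p ∈ Nat.primesLE n, Real.log p / p ≤ n * (Real.log n + Real.log 4) := by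
    calc n * ∑ p ∈ Nat.primesLE n, Real.log p / p
        ≤ ∑ p ∈ Nat.primesLE n, (((n / p : ℕ) : ℝ) * Real.log p + Real.log p) := by
          rw [mul_sum]
          refine sum_le_sum fun p hp => ?_
          have hp0 : (0 : ℝ) < p := by exact_mod_cast (Nat.prime_of_mem_primesLE hp).pos
          have hl : 0 ≤ Real.log p := Real.log_natCast_nonneg p
          have : (n : ℝ) / p ≤ (n / p : ℕ) + 1 := by
            rw [← Nat.floor_div_eq_div (K := ℝ)]
            exact (Nat.lt_floor_add_one _).le
          calc n * (Real.log p / p) = n / p * Real.log p := by ring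
            _ ≤ ((n / p : ℕ) + 1) * Real.log p := by gcongr
            _ = _ := by ring
      _ ≤ n * (Real.log n + Real.log 4) := by
          rw [sum_add_distrib]
          linarith
  exact le_of_mul_le_mul_left h3 hn0

/-- Bounds the mass of one sieve block. For `y ≥ 2`, `log y ≤ log p` and Mertens' first theorem up
to `y²` give at most `2 log y + log 4 ≤ 4 log y`. -/
theorem sum_inv_primes_le_four {y : ℝ} (hy : 1 ≤ y) {s : Finset ℕ}
    (hs : ∀ p ∈ s, p.Prime ∧ y < p ∧ (p : ℝ) ≤ y ^ 2) : ∑ p ∈ s, (p : ℝ)⁻¹ ≤ 4 := by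
  rcases lt_or_ge y 2 with h2 | h2
  · have hsub : s ⊆ Icc 1 3 := by
      intro p hp
      obtain ⟨h1, -, h3⟩ := hs p hp
      have : (p : ℝ) < 4 := by nlinarith
      rw [mem_Icc]
      exact ⟨h1.pos, by exact_mod_cast Nat.lt_succ_iff.1 (by exact_mod_cast this : p < 3 + 1)⟩
    calc ∑ p ∈ s, (p : ℝ)⁻¹ ≤ ∑ p ∈ Icc (1 : ℕ) 3, (p : ℝ)⁻¹ :=
          sum_le_sum_of_subset_of_nonneg hsub fun _ _ _ => by positivity
      _ ≤ 4 := by norm_num [Finset.sum_Icc_succ_top]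
  · have hl : 0 < Real.log y := Real.log_pos (by linarith)
    set n := ⌊y ^ 2⌋₊ with hn
    have hn0 : n ≠ 0 := (Nat.floor_pos.2 (by nlinarith)).ne'
    have hsub : s ⊆ Nat.primesLE n := fun p hp => Nat.mem_primesLE.2
      ⟨Nat.le_floor (hs p hp).2.2, (hs p hp).1⟩
    have h3 : Real.log y * ∑ p ∈ s, (p : ℝ)⁻¹ ≤ Real.log n + Real.log 4 := by
      refine le_trans ?_ (sum_primesLE_log_div_le n hn0)
      rw [mul_sum]
      refine le_trans (sum_le_sum fun p hp => ?_) (sum_le_sum_of_subset_of_nonneg hsub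
        fun p hp _ => div_nonneg (Real.log_natCast_nonneg p) (Nat.cast_nonneg p))
      rw [div_eq_mul_inv]
      have := Real.log_le_log (by linarith) (hs p hp).2.1.le
      gcongr
    have h4 : Real.log n ≤ 2 * Real.log y := by
      have : (n : ℝ) ≤ y ^ 2 := Nat.floor_le (by positivity)
      calc Real.log n ≤ Real.log (y ^ 2) :=
            Real.log_le_log (by exact_mod_cast Nat.pos_of_ne_zero hn0) this
        _ = 2 * Real.log y := by rw [Real.log_pow]; norm_num
    have h5 : Real.log 4 ≤ 2 * Real.log y := by
      rw [show (4 : ℝ) = 2 ^ 2 by norm_num, Real.log_pow]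
      have := Real.log_le_log (by norm_num) h2
      push_cast
      linarith
    refine le_of_mul_le_mul_left ?_ hl
    linarith

/-- The Euler product expands to the sum of `1 / k` over all `k` without prime factors above `n`,
which include every `k ≤ n`. -/
theorem harmonic_le_prod_primesLE (n : ℕ) :
    ∑ k ∈ Icc 1 n, (k : ℝ)⁻¹ ≤ ∏ p ∈ Nat.primesLE n, (1 - (p : ℝ)⁻¹)⁻¹ := by
  let g : ℕ →* ℝ :=
    { toFun := fun k => (k : ℝ)⁻¹
      map_one' := by simp
      map_mul' := fun a b => by simp [mul_comm] }
  have hg : ∀ {p : ℕ}, p.Prime → ‖g p‖ < 1 := by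
    intro p hp
    change ‖(p : ℝ)⁻¹‖ < 1
    rw [norm_inv, Real.norm_natCast]
    exact inv_lt_one_of_one_lt₀ (by exact_mod_cast hp.one_lt)
  have h1 := (EulerProduct.summable_and_hasSum_smoothNumbers_prod_primesBelow_geometric hg
    (n + 1)).2
  have hmem : ∀ k : ℕ, k ∈ Icc 1 n → k ∈ (n + 1).smoothNumbers := fun k hk => by
    rw [mem_Icc] at hk
    exact Nat.mem_smoothNumbers_of_lt hk.1 (by lia)
  have h2 := sum_le_hasSum ((Icc 1 n).subtype (· ∈ (n + 1).smoothNumbers))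
    (fun k _ => inv_nonneg.2 (Nat.cast_nonneg (k : ℕ))) h1
  rw [Finset.sum_subtype_eq_sum_filter (f := fun k : ℕ => g k),
    Finset.filter_true_of_mem hmem] at h2
  exact h2

/-- The lower bound in Mertens' second theorem. -/
theorem log_log_le_sum_inv_primes {z : ℝ} (hz : 1 < z) :
    Real.log (Real.log z) ≤ ∑ p ∈ Nat.primesLE ⌊z⌋₊, (p : ℝ)⁻¹ + 1 := by
  set n := ⌊z⌋₊
  have hlog : 0 < Real.log z := Real.log_pos hz
  have h1 : Real.log z ≤ ∑ k ∈ Icc 1 n, (k : ℝ)⁻¹ := by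
    have := Real.log_le_log (by linarith) (Nat.lt_floor_add_one z).le
    have h := log_add_one_le_harmonic n
    rw [harmonic_eq_sum_Icc] at h
    push_cast at h
    exact this.trans h
  -- Each factor is `1 + 1 / (p - 1) ≤ exp (1 / (p - 1))`. The excess over `1 / p` is split off
  -- because it telescopes to at most `1`.
  have h2 : ∏ p ∈ Nat.primesLE n, (1 - (p : ℝ)⁻¹)⁻¹
      ≤ Real.exp (∑ p ∈ Nat.primesLE n, ((p : ℝ)⁻¹ + (((p : ℝ) - 1)⁻¹ - (p : ℝ)⁻¹))) := by
    rw [Real.exp_sum]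
    have hp1 : ∀ p ∈ Nat.primesLE n, (1 : ℝ) < p := fun p hp => by
      exact_mod_cast (Nat.prime_of_mem_primesLE hp).one_lt
    refine prod_le_prod (fun p hp => ?_) fun p hp => ?_
    · exact inv_nonneg.2 (sub_nonneg.2 (inv_le_one_of_one_le₀ (hp1 p hp).le))
    · have h0 := hp1 p hp
      have h3 : (1 - (p : ℝ)⁻¹)⁻¹ = ((p : ℝ) - 1)⁻¹ + 1 := by
        have : (p : ℝ) - 1 ≠ 0 := by linarith
        have : (p : ℝ) ≠ 0 := by linarith
        field_simp
        ring
      rw [h3, add_sub_cancel]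
      exact Real.add_one_le_exp _
  have h3 : ∑ p ∈ Nat.primesLE n, (((p : ℝ) - 1)⁻¹ - (p : ℝ)⁻¹) ≤ 1 := by
    have htel : ∀ m : ℕ, ∑ k ∈ range m, (((k : ℝ) + 1)⁻¹ - ((k : ℝ) + 2)⁻¹) ≤ 1 := by
      intro m
      have := Finset.sum_range_sub' (fun k : ℕ => ((k : ℝ) + 1)⁻¹) m
      have h4 : ∑ k ∈ range m, (((k : ℝ) + 1)⁻¹ - ((k : ℝ) + 2)⁻¹) = 1 - ((m : ℝ) + 1)⁻¹ := by
        simp only [Nat.cast_zero, zero_add, inv_one] at this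
        rw [← this]
        refine sum_congr rfl fun k _ => ?_
        push_cast
        ring_nf
      rw [h4]
      have : 0 ≤ ((m : ℝ) + 1)⁻¹ := by positivity
      linarith
    refine le_trans ?_ (htel n)
    have h5 : ∑ p ∈ Nat.primesLE n, (((p : ℝ) - 1)⁻¹ - (p : ℝ)⁻¹)
        = ∑ k ∈ (Nat.primesLE n).image (fun p : ℕ => p - 2), (((k : ℝ) + 1)⁻¹ - ((k : ℝ) + 2)⁻¹) := by
      rw [sum_image]
      · refine sum_congr rfl fun p hp => ?_
        rw [Nat.cast_sub (Nat.two_le_of_mem_primesLE hp)]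
        push_cast
        ring_nf
      · intro a ha b hb hab
        have := Nat.two_le_of_mem_primesLE ha
        have := Nat.two_le_of_mem_primesLE hb
        simp only at hab
        lia
    rw [h5]
    refine sum_le_sum_of_subset_of_nonneg ?_ fun k _ _ => ?_
    · intro k hk
      obtain ⟨p, hp, rfl⟩ := mem_image.1 hk
      have := Nat.two_le_of_mem_primesLE hp
      have := Nat.le_of_mem_primesLE hp
      rw [mem_range]
      lia
    · exact sub_nonneg.2 (inv_anti₀ (by positivity) (by linarith))
  rw [Real.log_le_iff_le_exp hlog]
  refine h1.trans ((harmonic_le_prod_primesLE n).trans (h2.trans ?_))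
  rw [sum_add_distrib]
  gcongr

/-! ### Truncated inclusion–exclusion. -/

/-- The inclusion-exclusion sum for `∏ p ∈ P, (1 - x p)`, truncated to subsets of size at most
`k`. -/
noncomputable def truncSum (x : ℕ → ℝ) (P : Finset ℕ) (k : ℕ) : ℝ :=
  ∑ S ∈ P.powerset with #S ≤ k, ∏ p ∈ S, -x p

theorem truncSum_zero (x : ℕ → ℝ) (P : Finset ℕ) : truncSum x P 0 = 1 := by
  have : {S ∈ P.powerset | #S ≤ 0} = {∅} := by
    ext S
    simp only [mem_filter, mem_powerset, nonpos_iff_eq_zero, card_eq_zero, mem_singleton]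
    exact ⟨fun h => h.2, fun h => ⟨h ▸ empty_subset _, h⟩⟩
  rw [truncSum, this]
  simp

/-- A Pascal-type recursion, from splitting the subsets by whether they contain `q`; it drives the
induction in `bonferroni`. -/
theorem truncSum_insert (x : ℕ → ℝ) {P : Finset ℕ} {q : ℕ} (hq : q ∉ P) (k : ℕ) :
    truncSum x (insert q P) (k + 1) = truncSum x P (k + 1) - x q * truncSum x P k := by
  simp only [truncSum, sum_filter]
  rw [sum_powerset_insert hq, sub_eq_add_neg, ← neg_mul, mul_sum]
  congr 1
  refine sum_congr rfl fun S hS => ?_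
  have hqS : q ∉ S := fun h => hq (mem_powerset.1 hS h)
  rw [card_insert_of_notMem hqS, prod_insert hqS]
  simp

theorem pow_succ_add_mul_le_add_pow {L x : ℝ} (hL : 0 ≤ L) (hx : 0 ≤ x) (n : ℕ) :
    L ^ (n + 1) + (n + 1) * x * L ^ n ≤ (x + L) ^ (n + 1) := by
  induction n with
  | zero => simp [add_comm]
  | succ n ih =>
    have h1 := mul_le_mul_of_nonneg_right ih (add_nonneg hx hL)
    rw [← pow_succ] at h1
    have h2 : 0 ≤ (n + 1) * x ^ 2 * L ^ n := by positivity
    refine le_trans ?_ h1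
    push_cast
    linear_combination h2

theorem pow_div_factorial_add_le {L x : ℝ} (hL : 0 ≤ L) (hx : 0 ≤ x) (k : ℕ) :
    L ^ (k + 2) / (k + 2).factorial + x * (L ^ (k + 1) / (k + 1).factorial)
      ≤ (x + L) ^ (k + 2) / (k + 2).factorial := by
  have h1 : L ^ (k + 2) + (k + 2) * x * L ^ (k + 1) ≤ (x + L) ^ (k + 2) := by
    have := pow_succ_add_mul_le_add_pow hL hx (k + 1)
    push_cast at this
    linarith
  have h2 : x * (L ^ (k + 1) / (k + 1).factorial)
      = (k + 2) * x * L ^ (k + 1) / (k + 2).factorial := by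
    rw [Nat.factorial_succ (k + 1)]
    push_cast
    field_simp
    ring
  rw [h2, ← add_div]
  gcongr

/-- The weighted Bonferroni inequalities. -/
theorem bonferroni {x : ℕ → ℝ} {P : Finset ℕ} (hx : ∀ p ∈ P, 0 ≤ x p ∧ x p ≤ 1) (k : ℕ) :
    0 ≤ (-1) ^ k * (truncSum x P k - ∏ p ∈ P, (1 - x p)) ∧
      (-1) ^ k * (truncSum x P k - ∏ p ∈ P, (1 - x p))
        ≤ (∑ p ∈ P, x p) ^ (k + 1) / (k + 1).factorial := by
  induction P using Finset.induction_on generalizing k with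
  | empty =>
    have : truncSum x ∅ k = 1 := by simp [truncSum, filter_singleton]
    simp [this]
  | insert q P hq ih =>
    have hxP : ∀ p ∈ P, 0 ≤ x p ∧ x p ≤ 1 := fun p hp => hx p (mem_insert_of_mem hp)
    have ih := ih hxP
    obtain ⟨hq0, hq1⟩ := hx q (mem_insert_self q P)
    have hL : 0 ≤ ∑ p ∈ P, x p := sum_nonneg fun p hp => (hxP p hp).1
    have hV0 : 0 ≤ ∏ p ∈ P, (1 - x p) := prod_nonneg fun p hp => sub_nonneg.2 (hxP p hp).2
    rw [prod_insert hq, sum_insert hq]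
    cases k with
    | zero =>
      have h0 := ih 0
      rw [truncSum_zero] at h0 ⊢
      simp only [pow_zero, one_mul, zero_add, pow_one, Nat.factorial_one, Nat.cast_one,
        div_one] at h0 ⊢
      constructor <;> nlinarith
    | succ k =>
      -- With the sign included, the errors at levels `k + 1` and `k` enter with nonnegative
      -- coefficients, so both bounds propagate.
      have heq : (-1) ^ (k + 1) * (truncSum x (insert q P) (k + 1) -
          (1 - x q) * ∏ p ∈ P, (1 - x p)) =
          (-1) ^ (k + 1) * (truncSum x P (k + 1) - ∏ p ∈ P, (1 - x p)) +
          x q * ((-1) ^ k * (truncSum x P k - ∏ p ∈ P, (1 - x p))) := by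
        rw [truncSum_insert x hq]
        ring
      rw [heq]
      obtain ⟨h1, h2⟩ := ih (k + 1)
      obtain ⟨h3, h4⟩ := ih k
      refine ⟨by positivity, ?_⟩
      exact (add_le_add h2 (mul_le_mul_of_nonneg_left h4 hq0)).trans
        (pow_div_factorial_add_le hL hq0 k)

theorem prod_one_sub_le_truncSum {x : ℕ → ℝ} {P : Finset ℕ}
    (hx : ∀ p ∈ P, 0 ≤ x p ∧ x p ≤ 1) (j : ℕ) :
    ∏ p ∈ P, (1 - x p) ≤ truncSum x P (2 * j) := by
  have := (bonferroni hx (2 * j)).1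
  rw [pow_mul] at this
  norm_num at this
  exact this

/-- Turns the additive Bonferroni error into a multiplicative one, so that the bounds can be
multiplied over blocks; the price is `exp B ≥ exp (∑ x p)`. -/
theorem truncSum_le {x : ℕ → ℝ} {P : Finset ℕ} (hx : ∀ p ∈ P, 0 ≤ x p ∧ x p ≤ 1) {B : ℝ}
    (hB : ∑ p ∈ P, x p ≤ B) (j : ℕ) :
    truncSum x P (2 * j) ≤ Real.exp (-∑ p ∈ P, x p) *
      Real.exp (Real.exp B * (B ^ (2 * j + 1) / (2 * j + 1).factorial)) := by
  have h1 := (bonferroni hx (2 * j)).2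
  rw [pow_mul] at h1
  norm_num at h1
  set L := ∑ p ∈ P, x p
  have hL : 0 ≤ L := sum_nonneg fun p hp => (hx p hp).1
  set T := B ^ (2 * j + 1) / ((2 * j + 1).factorial : ℝ)
  have hT : L ^ (2 * j + 1) / ((2 * j + 1).factorial : ℝ) ≤ T := by
    simp only [T]; gcongr
  have hT0 : 0 ≤ T := le_trans (by positivity) hT
  have h2 : ∏ p ∈ P, (1 - x p) ≤ Real.exp (-L) := by
    rw [← sum_neg_distrib, Real.exp_sum]
    refine prod_le_prod (fun p hp => sub_nonneg.2 (hx p hp).2) fun p _ => ?_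
    have := Real.add_one_le_exp (-x p)
    linarith
  have h3 : T ≤ Real.exp (-L) * (Real.exp B * T) := by
    rw [← mul_assoc, ← Real.exp_add]
    exact le_mul_of_one_le_left hT0 (Real.one_le_exp (by linarith))
  calc truncSum x P (2 * j) ≤ Real.exp (-L) * (Real.exp B * T + 1) := by
        rw [mul_add, mul_one]; linarith
    _ ≤ _ := by gcongr; exact Real.add_one_le_exp _

/-! ### The Brun–Hooley sieve. -/

/-- A product of truncated sums over disjoint blocks is a sum over a family of sets whose
products are bounded. -/
theorem exists_prod_truncSum_eq (P : ℕ → Finset ℕ) (y : ℕ → ℝ) (k : ℕ → ℕ)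
    (hdisj : ∀ i j, i ≠ j → Disjoint (P i) (P j)) (hy : ∀ j, 1 ≤ y j)
    (hP : ∀ j, ∀ p ∈ P j, (p : ℝ) ≤ y j) (J : ℕ) :
    ∃ 𝒟 : Finset (Finset ℕ),
      (∀ S ∈ 𝒟, S ⊆ (range J).biUnion P ∧ ∏ p ∈ S, (p : ℝ) ≤ ∏ j ∈ range J, y j ^ k j) ∧
      ∀ x : ℕ → ℝ, ∏ j ∈ range J, truncSum x (P j) (k j) = ∑ S ∈ 𝒟, ∏ p ∈ S, -x p := by
  induction J with
  | zero => exact ⟨{∅}, by simp, by simp⟩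
  | succ J ih =>
    obtain ⟨𝒟, h𝒟, hsum⟩ := ih
    set E := {S ∈ (P J).powerset | #S ≤ k J} with hE
    have hd : Disjoint ((range J).biUnion P) (P J) := by
      rw [disjoint_biUnion_left]
      exact fun i hi => hdisj i J (mem_range.1 hi).ne
    have hdis : ∀ S ∈ 𝒟, ∀ T ∈ E, Disjoint S T := fun S hS T hT =>
      disjoint_of_subset_left (h𝒟 S hS).1 (disjoint_of_subset_right
        (mem_powerset.1 (mem_filter.1 hT).1) hd)
    refine ⟨(𝒟 ×ˢ E).image fun u => u.1 ∪ u.2, ?_, ?_⟩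
    · intro U hU
      obtain ⟨⟨S, T⟩, hST, rfl⟩ := mem_image.1 hU
      rw [mem_product] at hST
      obtain ⟨hS, hT⟩ := hST
      simp only at hS hT ⊢
      obtain ⟨h1, h2⟩ := h𝒟 S hS
      have hT' := mem_filter.1 hT
      have hTP := mem_powerset.1 hT'.1
      constructor
      · rw [range_add_one, biUnion_insert, union_comm]
        exact union_subset_union hTP h1
      · rw [prod_union (hdis S hS T hT), prod_range_succ]
        have h3 : ∏ p ∈ T, (p : ℝ) ≤ y J ^ k J := by
          calc ∏ p ∈ T, (p : ℝ) ≤ ∏ p ∈ T, y J :=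
                prod_le_prod (fun _ _ => Nat.cast_nonneg _) fun p hp => hP J p (hTP hp)
            _ = y J ^ #T := by rw [prod_const]
            _ ≤ y J ^ k J := pow_le_pow_right₀ (hy J) hT'.2
        have h4 : 0 ≤ ∏ p ∈ T, (p : ℝ) := prod_nonneg fun _ _ => Nat.cast_nonneg _
        have h5 : 0 ≤ ∏ p ∈ S, (p : ℝ) := prod_nonneg fun _ _ => Nat.cast_nonneg _
        exact mul_le_mul h2 h3 h4 (h5.trans h2)
    · intro x
      rw [prod_range_succ, hsum, truncSum, ← hE, sum_mul_sum, ← sum_product', sum_image]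
      · refine sum_congr rfl fun u hu => ?_
        rw [mem_product] at hu
        rw [prod_union (hdis _ hu.1 _ hu.2)]
      · rintro ⟨S, T⟩ hu ⟨S', T'⟩ hv huv
        rw [mem_coe, mem_product] at hu hv
        simp only at hu hv huv
        -- Disjoint blocks let `S` and `T` be recovered from `S ∪ T`, so the reindexing is
        -- injective.
        have key : ∀ S ∈ 𝒟, ∀ T ∈ E, (S ∪ T) ∩ P J = T ∧ (S ∪ T) \ P J = S := by
          intro S hS T hT
          have h1 : Disjoint S (P J) := disjoint_of_subset_left (h𝒟 S hS).1 hd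
          have h2 : T ⊆ P J := mem_powerset.1 (mem_filter.1 hT).1
          constructor
          · rw [union_inter_distrib_right, disjoint_iff_inter_eq_empty.1 h1, empty_union,
              inter_eq_left.2 h2]
          · rw [union_sdiff_distrib, sdiff_eq_self_of_disjoint h1, sdiff_eq_empty_iff_subset.2 h2,
              union_empty]
        obtain ⟨a1, a2⟩ := key S hu.1 T hu.2
        obtain ⟨b1, b2⟩ := key S' hv.1 T' hv.2
        rw [huv] at a1 a2
        rw [← a1, ← a2, b1, b2]

theorem sum_range_mul_half_pow_le (J : ℕ) : ∑ j ∈ range J, (j : ℝ) * (1 / 2) ^ j ≤ 2 := by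
  have h : ∑ j ∈ range J, (j : ℝ) * (1 / 2) ^ j = 2 - 2 * (J + 1) * (1 / 2) ^ J := by
    induction J with
    | zero => simp
    | succ J ih =>
      rw [sum_range_succ, ih, pow_succ]
      push_cast
      ring
  rw [h]
  have : (0 : ℝ) ≤ 2 * (J + 1) * (1 / 2) ^ J := by positivity
  linarith

/-- The primes in `(z^(1/2^(j+1)), z^(1/2^j)]`. -/
noncomputable def primeBlock (z : ℝ) (j : ℕ) : Finset ℕ :=
  {p ∈ Nat.primesLE ⌊z⌋₊ | z ^ ((1 / 2 : ℝ) ^ (j + 1)) < p ∧ (p : ℝ) ≤ z ^ ((1 / 2 : ℝ) ^ j)}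

theorem rpow_half_pow_succ_sq {z : ℝ} (hz : 0 ≤ z) (j : ℕ) :
    (z ^ ((1 / 2 : ℝ) ^ (j + 1))) ^ 2 = z ^ ((1 / 2 : ℝ) ^ j) := by
  rw [← Real.rpow_mul_natCast hz]
  congr 1
  rw [pow_succ]
  push_cast
  ring

theorem disjoint_primeBlock {z : ℝ} (hz : 1 ≤ z) {i j : ℕ} (hij : i ≠ j) :
    Disjoint (primeBlock z i) (primeBlock z j) := by
  have key : ∀ i j, i < j → Disjoint (primeBlock z i) (primeBlock z j) := by
    intro i j hij
    rw [disjoint_left]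
    intro p hp hq
    have h1 := (mem_filter.1 hp).2.1
    have h2 := (mem_filter.1 hq).2.2
    have h3 : z ^ ((1 / 2 : ℝ) ^ j) ≤ z ^ ((1 / 2 : ℝ) ^ (i + 1)) :=
      Real.rpow_le_rpow_of_exponent_le hz
        (pow_le_pow_of_le_one (by norm_num) (by norm_num) hij)
    linarith
  rcases lt_or_gt_of_ne hij with h | h
  · exact key i j h
  · exact (key j i h).symm

/-- The block endpoints tend to `1`, so they eventually fall below the smallest prime. A prime lies
in the block ending at the first endpoint below it. -/
theorem exists_primesLE_subset_biUnion_primeBlock {z : ℝ} (hz : 1 ≤ z) :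
    ∃ J, Nat.primesLE ⌊z⌋₊ ⊆ (range J).biUnion (primeBlock z) := by
  have htend : Filter.Tendsto (fun j : ℕ => z ^ ((1 / 2 : ℝ) ^ j)) Filter.atTop
      (nhds (z ^ (0 : ℝ))) :=
    (Real.continuous_const_rpow (by linarith : z ≠ 0)).continuousAt.tendsto.comp
      (tendsto_pow_atTop_nhds_zero_of_lt_one (by norm_num) (by norm_num))
  rw [Real.rpow_zero] at htend
  obtain ⟨J, hJ⟩ := (htend.eventually_lt_const (by norm_num : (1 : ℝ) < 2)).exists
  refine ⟨J, fun p hp => ?_⟩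
  have hp2 : (2 : ℝ) ≤ p := by exact_mod_cast Nat.two_le_of_mem_primesLE hp
  have hpz : (p : ℝ) ≤ z := (Nat.le_floor_iff (by linarith)).1 (Nat.le_of_mem_primesLE hp)
  have hex : ∃ j, z ^ ((1 / 2 : ℝ) ^ j) < p := ⟨J, by linarith⟩
  classical
  have hspec := Nat.find_spec hex
  have hle : Nat.find hex ≤ J := Nat.find_min' hex (by linarith)
  have hmin := fun i => @Nat.find_min _ _ hex i
  generalize Nat.find hex = j at hspec hle hmin
  cases j with
  | zero => simp at hspec; linarith
  | succ j =>
    exact mem_biUnion.2 ⟨j, mem_range.2 hle, mem_filter.2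
      ⟨hp, hspec, not_lt.1 (hmin j (Nat.lt_succ_self j))⟩⟩

theorem map_le_prod_primeFactors {f : ArithmeticFunction ℝ} (hf : f.IsMultiplicative)
    (h1 : ∀ p : ℕ, p.Prime → 0 ≤ f p ∧ f p ≤ 1)
    (h2 : ∀ p m : ℕ, p.Prime → 2 ≤ m → 0 ≤ f (p ^ m) ∧ f (p ^ m) ≤ f p) {m : ℕ} (hm : m ≠ 0) :
    0 ≤ f m ∧ f m ≤ ∏ p ∈ m.primeFactors, f p := by
  have hpow : ∀ p ∈ m.primeFactors, 0 ≤ f (p ^ m.factorization p) ∧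
      f (p ^ m.factorization p) ≤ f p := by
    intro p hp
    have hp' := Nat.prime_of_mem_primeFactors hp
    have h0 := hp'.factorization_pos_of_dvd hm (Nat.dvd_of_mem_primeFactors hp)
    rcases Nat.lt_or_ge (m.factorization p) 2 with h | h
    · have : m.factorization p = 1 := by lia
      rw [this, pow_one]
      exact ⟨(h1 p hp').1, le_rfl⟩
    · exact h2 p _ hp' h
  rw [hf.multiplicative_factorization f hm, Finsupp.prod, Nat.support_factorization]
  exact ⟨prod_nonneg fun p hp => (hpow p hp).1,
    prod_le_prod (fun p hp => (hpow p hp).1) fun p hp => (hpow p hp).2⟩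

/-- The Brun–Hooley upper bound sieve, weighted by `1 - f p`. -/
theorem exists_sieve_majorant {f : ArithmeticFunction ℝ} (hf : f.IsMultiplicative)
    (h1 : ∀ p : ℕ, p.Prime → 0 ≤ f p ∧ f p ≤ 1)
    (h2 : ∀ p m : ℕ, p.Prime → 2 ≤ m → 0 ≤ f (p ^ m) ∧ f (p ^ m) ≤ f p) {z : ℝ} (hz : 1 ≤ z) :
    ∃ (𝒟 : Finset ℕ) (w : ℕ → ℝ),
      (∀ d ∈ 𝒟, 0 < d ∧ (d : ℝ) ≤ z ^ 4) ∧ (∀ d ∈ 𝒟, |w d| ≤ 1) ∧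
      (∀ m ≠ 0, f m ≤ ∑ d ∈ 𝒟, if d ∣ m then w d else 0) ∧
      ∑ d ∈ 𝒟, w d / d ≤
        Real.exp (Real.exp 8) * Real.exp (-∑ p ∈ Nat.primesLE ⌊z⌋₊, (1 - f p) / p) := by
  obtain ⟨J, hJ⟩ := exists_primesLE_subset_biUnion_primeBlock hz
  set y : ℕ → ℝ := fun j => z ^ ((1 / 2 : ℝ) ^ j) with hy
  have hy1 : ∀ j, 1 ≤ y j := fun j => Real.one_le_rpow hz (by positivity)
  have hdisj : ∀ i j, i ≠ j → Disjoint (primeBlock z i) (primeBlock z j) :=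
    fun i j h => disjoint_primeBlock hz h
  obtain ⟨𝒮, h𝒮, hprod⟩ := exists_prod_truncSum_eq (primeBlock z) y (fun j => 2 * j) hdisj hy1
    (fun j p hp => (mem_filter.1 hp).2.2) J
  set U := (range J).biUnion (primeBlock z)
  have hUp : ∀ p ∈ U, p.Prime := fun p hp => by
    obtain ⟨j, -, hj⟩ := mem_biUnion.1 hp
    exact Nat.prime_of_mem_primesLE (mem_filter.1 hj).1
  have hblock : ∀ j, ∀ p ∈ primeBlock z j, p.Prime := fun j p hp =>
    Nat.prime_of_mem_primesLE (mem_filter.1 hp).1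
  have hSp : ∀ S ∈ 𝒮, ∀ p ∈ S, p.Prime := fun S hS p hp => hUp p ((h𝒮 S hS).1 hp)
  have hpf : ∀ S ∈ 𝒮, (∏ p ∈ S, p).primeFactors = S := fun S hS =>
    Nat.primeFactors_prod (hSp S hS)
  have hinj : Set.InjOn (fun S : Finset ℕ => ∏ p ∈ S, p) 𝒮 := by
    intro S hS T hT hST
    simp only at hST
    rw [← hpf S hS, ← hpf T hT, hST]
  -- Block `j` allows at most `2 * j` primes of size at most `z ^ (1 / 2 ^ j)`, so the exponent is
  -- `∑ 2 j / 2 ^ j ≤ 4`.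
  have hlevel : ∏ j ∈ range J, y j ^ (2 * j) ≤ z ^ 4 := by
    have : ∀ j ∈ range J, y j ^ (2 * j) = z ^ ((2 : ℝ) * (j * (1 / 2) ^ j)) := by
      intro j _
      rw [hy, ← Real.rpow_mul_natCast (by linarith)]
      push_cast
      ring_nf
    rw [prod_congr rfl this, ← Real.rpow_sum_of_pos (by linarith), ← mul_sum,
      ← Real.rpow_natCast]
    refine Real.rpow_le_rpow_of_exponent_le hz ?_
    have := sum_range_mul_half_pow_le J
    push_cast
    linarith
  have hh : ∀ p : ℕ, p.Prime → 0 ≤ 1 - f p ∧ 1 - f p ≤ 1 := fun p hp =>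
    ⟨by linarith [(h1 p hp).2], by linarith [(h1 p hp).1]⟩
  refine ⟨𝒮.image fun S => ∏ p ∈ S, p, fun d => ∏ p ∈ d.primeFactors, -(1 - f p),
    ?_, ?_, ?_, ?_⟩
  · intro d hd
    obtain ⟨S, hS, rfl⟩ := mem_image.1 hd
    refine ⟨prod_pos fun p hp => (hSp S hS p hp).pos, ?_⟩
    rw [Nat.cast_prod]
    exact (h𝒮 S hS).2.trans hlevel
  · intro d _
    rw [abs_prod]
    refine prod_le_one (fun _ _ => abs_nonneg _) fun p hp => ?_
    obtain ⟨a, b⟩ := hh p (Nat.prime_of_mem_primeFactors hp)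
    rwa [abs_neg, abs_of_nonneg a]
  · intro m hm
    -- With this `x`, `∏ (1 - x p)` is the product of `f p` over the sieved primes dividing `m`.
    set x : ℕ → ℝ := fun p => if p ∣ m then 1 - f p else 0 with hx
    have hx01 : ∀ p, p.Prime → 0 ≤ x p ∧ x p ≤ 1 := by
      intro p hp
      simp only [hx]
      split_ifs
      · exact hh p hp
      · norm_num
    have hsum : ∑ d ∈ 𝒮.image (fun S => ∏ p ∈ S, p),
        (if d ∣ m then ∏ p ∈ d.primeFactors, -(1 - f p) else 0)
        = ∏ j ∈ range J, truncSum x (primeBlock z j) (2 * j) := by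
      rw [hprod x, sum_image hinj]
      refine sum_congr rfl fun S hS => ?_
      rw [hpf S hS]
      split_ifs with hd
      · refine prod_congr rfl fun p hp => ?_
        simp only [hx]
        rw [if_pos ((dvd_prod_of_mem _ hp).trans hd)]
      · have : ∃ p ∈ S, ¬ p ∣ m := by
          by_contra hcon
          push Not at hcon
          exact hd (Finset.prod_primes_dvd m (fun p hp => (hSp S hS p hp).prime) hcon)
        obtain ⟨p, hp, hpm⟩ := this
        symm
        refine prod_eq_zero hp ?_
        simp [hx, hpm]
    rw [hsum]
    calc f m ≤ ∏ p ∈ m.primeFactors, f p := (map_le_prod_primeFactors hf h1 h2 hm).2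
      _ ≤ ∏ p ∈ m.primeFactors with p ∈ U, f p := by
          rw [← prod_filter_mul_prod_filter_not m.primeFactors (· ∈ U)]
          refine mul_le_of_le_one_right (prod_nonneg fun p hp => ?_) (prod_le_one ?_ ?_)
          · exact (h1 p (Nat.prime_of_mem_primeFactors (mem_filter.1 hp).1)).1
          · exact fun p hp => (h1 p (Nat.prime_of_mem_primeFactors (mem_filter.1 hp).1)).1
          · exact fun p hp => (h1 p (Nat.prime_of_mem_primeFactors (mem_filter.1 hp).1)).2
      _ = ∏ p ∈ U, (1 - x p) := by
          have : ∀ p, 1 - x p = if p ∣ m then f p else 1 := by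
            intro p
            simp only [hx]
            split_ifs <;> ring
          simp_rw [this]
          rw [← prod_filter]
          congr 1
          ext p
          simp only [mem_filter, Nat.mem_primeFactors]
          exact ⟨fun h => ⟨h.2, h.1.2.1⟩, fun h => ⟨⟨hUp p h.1, h.2, hm⟩, h.1⟩⟩
      _ = ∏ j ∈ range J, ∏ p ∈ primeBlock z j, (1 - x p) :=
          prod_biUnion fun i _ j _ hij => hdisj i j hij
      _ ≤ _ := by
          -- The block products are nonnegative, so their even-level upper bounds may be multiplied.
          refine prod_le_prod (fun j _ => prod_nonneg fun p hp => ?_) fun j _ => ?_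
          · exact sub_nonneg.2 (hx01 p (hblock j p hp)).2
          · exact prod_one_sub_le_truncSum (fun p hp => hx01 p (hblock j p hp)) j
  -- The same identity with the density of divisibility by `p` in place of its indicator evaluates
  -- `∑ w d / d`.
  · set x : ℕ → ℝ := fun p => (1 - f p) / p with hx
    have hxinv : ∀ p, p.Prime → 0 ≤ x p ∧ x p ≤ (p : ℝ)⁻¹ := by
      intro p hp
      obtain ⟨a, b⟩ := hh p hp
      simp only [hx, div_eq_mul_inv]
      exact ⟨mul_nonneg a (by positivity), mul_le_of_le_one_left (by positivity) b⟩
    have hx01 : ∀ p, p.Prime → 0 ≤ x p ∧ x p ≤ 1 := fun p hp =>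
      ⟨(hxinv p hp).1, (hxinv p hp).2.trans
        (inv_le_one_of_one_le₀ (by exact_mod_cast hp.one_lt.le))⟩
    have hsum : ∑ d ∈ 𝒮.image (fun S => ∏ p ∈ S, p), (∏ p ∈ d.primeFactors, -(1 - f p)) / (d : ℝ)
        = ∏ j ∈ range J, truncSum x (primeBlock z j) (2 * j) := by
      rw [hprod x, sum_image hinj]
      refine sum_congr rfl fun S hS => ?_
      rw [hpf S hS, Nat.cast_prod, ← prod_div_distrib]
      exact prod_congr rfl fun p _ => by simp only [hx]; ring
    have hL : ∀ j, ∑ p ∈ primeBlock z j, x p ≤ 4 := by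
      intro j
      refine (sum_le_sum fun p hp => (hxinv p (hblock j p hp)).2).trans
        (sum_inv_primes_le_four (hy1 (j + 1)) fun p hp => ?_)
      refine ⟨hblock j p hp, (mem_filter.1 hp).2.1, ?_⟩
      rw [hy, rpow_half_pow_succ_sq (by linarith)]
      exact (mem_filter.1 hp).2.2
    rw [hsum]
    calc ∏ j ∈ range J, truncSum x (primeBlock z j) (2 * j)
        ≤ ∏ j ∈ range J, (Real.exp (-∑ p ∈ primeBlock z j, x p) *
          Real.exp (Real.exp 4 * ((4 : ℝ) ^ (2 * j + 1) / (2 * j + 1).factorial))) := by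
          refine prod_le_prod (fun j _ => ?_) fun j _ =>
            truncSum_le (fun p hp => hx01 p (hblock j p hp)) (hL j) j
          refine le_trans (prod_nonneg fun p hp => ?_)
            (prod_one_sub_le_truncSum (fun p hp => hx01 p (hblock j p hp)) j)
          exact sub_nonneg.2 (hx01 p (hblock j p hp)).2
      _ = Real.exp (-∑ p ∈ U, x p) * Real.exp (Real.exp 4 *
          ∑ j ∈ range J, ((4 : ℝ) ^ (2 * j + 1) / (2 * j + 1).factorial)) := by
          rw [prod_mul_distrib, ← Real.exp_sum, ← Real.exp_sum, sum_neg_distrib, mul_sum,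
            sum_biUnion fun i _ j _ hij => hdisj i j hij]
      -- The block errors are odd-index terms of the series for `exp 4`, whence the constant `exp
      -- (exp 8)`.
      _ ≤ Real.exp (-∑ p ∈ Nat.primesLE ⌊z⌋₊, x p) * Real.exp (Real.exp 4 * Real.exp 4) := by
          have hodd : ∑ j ∈ range J, ((4 : ℝ) ^ (2 * j + 1) / (2 * j + 1).factorial)
              ≤ Real.exp 4 := by
            refine le_trans ?_ (Real.sum_le_exp_of_nonneg (by norm_num : (0 : ℝ) ≤ 4) (2 * J))
            rw [← sum_image (s := range J) (g := fun j : ℕ => 2 * j + 1)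
              (f := fun i : ℕ => (4 : ℝ) ^ i / i.factorial) (fun a _ b _ h => by simpa using h)]
            refine sum_le_sum_of_subset_of_nonneg (fun i hi => ?_) fun _ _ _ => by positivity
            obtain ⟨j, hj, rfl⟩ := mem_image.1 hi
            rw [mem_range] at hj ⊢
            lia
          have hsub : ∑ p ∈ Nat.primesLE ⌊z⌋₊, x p ≤ ∑ p ∈ U, x p :=
            sum_le_sum_of_subset_of_nonneg hJ fun p hp _ => (hx01 p (hUp p hp)).1
          gcongr
      _ = _ := by
          rw [mul_comm, ← Real.exp_add 4 4]
          norm_num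

/-! ### Mean value and character sums of the majorant. -/

/-- With `z = M ^ δ ≥ 2`, Mertens and the hypothesis give `∑ (1 - f p) / p ≥ (1 - α) log log z - 1 -
K`. The bound `δ ≤ δ ^ (1 - α)` keeps the constant free of `α`. If `z < 2`, then `log z ≤ 1` and the
estimate is trivial. -/
theorem exp_neg_sum_primesLE_le {f : ArithmeticFunction ℝ} {α K δ M : ℝ}
    (h1 : ∀ p : ℕ, p.Prime → 0 ≤ f p ∧ f p ≤ 1) (hα0 : 0 < α) (hα1 : α ≤ 1)
    (hK : ∀ X : ℝ, 2 ≤ X → |primeSum f X - α * Real.log (Real.log X)| ≤ K)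
    (hδ0 : 0 < δ) (hδ1 : δ ≤ 1) (hM : 2 ≤ M) :
    Real.exp (-∑ p ∈ Nat.primesLE ⌊M ^ δ⌋₊, (1 - f p) / p)
      ≤ Real.exp (1 + |K|) / δ / (Real.log M) ^ (1 - α) := by
  have hL : 0 < Real.log M := Real.log_pos (by linarith)
  have hP : 0 < (Real.log M) ^ (1 - α) := Real.rpow_pos_of_pos hL _
  have hβ : 0 ≤ 1 - α := by linarith
  have hlogz : Real.log (M ^ δ) = δ * Real.log M := Real.log_rpow (by linarith) _
  have hδpow : δ ≤ δ ^ (1 - α) := by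
    conv_lhs => rw [← Real.rpow_one δ]
    exact Real.rpow_le_rpow_of_exponent_ge hδ0 hδ1 (by linarith)
  rw [div_div, le_div_iff₀ (by positivity)]
  have hmul : δ * (Real.log M) ^ (1 - α) ≤ (Real.log (M ^ δ)) ^ (1 - α) := by
    rw [hlogz, Real.mul_rpow hδ0.le hL.le]
    gcongr
  have hlogz0 : 0 < Real.log (M ^ δ) := by rw [hlogz]; positivity
  refine (mul_le_mul_of_nonneg_left hmul (Real.exp_pos _).le).trans ?_
  rcases le_or_gt 2 (M ^ δ) with hz | hz
  · set z := M ^ δ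
    have hm := log_log_le_sum_inv_primes (by linarith : 1 < z)
    have hk := (abs_le.1 (hK z hz)).2
    rw [primeSum, ← Nat.primesLE_eq_filter_Icc_one] at hk
    have hsplit : ∑ p ∈ Nat.primesLE ⌊z⌋₊, (1 - f p) / p =
        ∑ p ∈ Nat.primesLE ⌊z⌋₊, (p : ℝ)⁻¹ - ∑ p ∈ Nat.primesLE ⌊z⌋₊, f p / p := by
      rw [← sum_sub_distrib]
      exact sum_congr rfl fun p _ => by ring
    rw [Real.rpow_def_of_pos hlogz0, ← Real.exp_add, hsplit]
    refine Real.exp_le_exp.2 ?_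
    have := le_abs_self K
    linarith
  · have hlog : Real.log (M ^ δ) ≤ 1 := by
      have := Real.log_le_sub_one_of_pos (Real.rpow_pos_of_pos (by linarith : 0 < M) δ)
      linarith
    have hsum : 0 ≤ ∑ p ∈ Nat.primesLE ⌊M ^ δ⌋₊, (1 - f p) / p := sum_nonneg fun p hp =>
      div_nonneg (by linarith [(h1 p (Nat.prime_of_mem_primesLE hp)).2]) (Nat.cast_nonneg p)
    calc _ ≤ (1 : ℝ) * 1 := by
          refine mul_le_mul (Real.exp_le_one_iff.2 (by linarith))
            (Real.rpow_le_one hlogz0.le hlog hβ) (by positivity) zero_le_one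
      _ ≤ _ := by
          rw [one_mul]
          exact Real.one_le_exp (by positivity)

theorem sum_Icc_sum_dvd_mul {R : Type*} [CommSemiring R] (𝒟 : Finset ℕ) (h𝒟 : ∀ d ∈ 𝒟, 0 < d)
    (w g : ℕ → R) (X : ℕ) :
    ∑ m ∈ Icc 1 X, (∑ d ∈ 𝒟, if d ∣ m then w d else 0) * g m
      = ∑ d ∈ 𝒟, w d * ∑ k ∈ Icc 1 (X / d), g (d * k) := by
  simp_rw [sum_mul, ite_mul, zero_mul]
  rw [sum_comm]
  refine sum_congr rfl fun d hd => ?_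
  rw [← sum_filter, ← mul_sum, sum_Icc_filter_dvd _ (h𝒟 d hd)]

theorem sum_Icc_sum_dvd_le {𝒟 : Finset ℕ} (h𝒟 : ∀ d ∈ 𝒟, 0 < d) {w : ℕ → ℝ}
    (hw : ∀ d ∈ 𝒟, |w d| ≤ 1) (X : ℕ) :
    ∑ m ∈ Icc 1 X, (∑ d ∈ 𝒟, if d ∣ m then w d else 0) ≤ X * ∑ d ∈ 𝒟, w d / d + #𝒟 := by
  have h := sum_Icc_sum_dvd_mul 𝒟 h𝒟 w (fun _ => (1 : ℝ)) X
  simp only [mul_one, sum_const, Nat.card_Icc, Nat.add_sub_cancel, nsmul_eq_mul] at h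
  rw [h, mul_sum, card_eq_sum_ones, Nat.cast_sum, ← sum_add_distrib]
  refine sum_le_sum fun d hd => ?_
  have h1 : ((X / d : ℕ) : ℝ) ≤ X / d := Nat.cast_div_le
  have h2 : (X : ℝ) / d ≤ (X / d : ℕ) + 1 := by
    rw [← Nat.floor_div_eq_div (K := ℝ)]
    exact (Nat.lt_floor_add_one _).le
  obtain ⟨h3, h4⟩ := abs_le.1 (hw d hd)
  rw [Nat.cast_one]
  have h5 : (X : ℝ) * (w d / d) = w d * (X / d) := by ring
  rw [h5]
  nlinarith

/-- Writing `m = d k` factors out `χ d`; Pólya–Vinogradov is uniform in the length `X / d`, so each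
`d` costs the same. -/
theorem norm_sum_sum_dvd_mul_char_le {q : ℕ} [NeZero q] {χ : DirichletCharacter ℂ q} (hχ : χ ≠ 1)
    {𝒟 : Finset ℕ} (h𝒟 : ∀ d ∈ 𝒟, 0 < d) {w : ℕ → ℝ} (hw : ∀ d ∈ 𝒟, |w d| ≤ 1) (X : ℕ) :
    ‖∑ m ∈ Icc 1 X, ((∑ d ∈ 𝒟, if d ∣ m then w d else 0 : ℝ) : ℂ) * χ (m : ZMod q)‖
      ≤ #𝒟 * (2 * √q * (1 + Real.log q)) := by
  have h := sum_Icc_sum_dvd_mul 𝒟 h𝒟 (fun d => (w d : ℂ)) (fun m => χ (m : ZMod q)) X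
  have hcast : ∀ m : ℕ, ((∑ d ∈ 𝒟, if d ∣ m then w d else 0 : ℝ) : ℂ)
      = ∑ d ∈ 𝒟, if d ∣ m then (w d : ℂ) else 0 := fun m => by
    rw [Complex.ofReal_sum]
    exact sum_congr rfl fun d _ => by split_ifs <;> simp
  simp_rw [hcast]
  rw [h, ← nsmul_eq_mul, ← sum_const]
  refine norm_sum_le_of_le _ fun d hd => ?_
  simp_rw [Nat.cast_mul, map_mul, ← mul_sum]
  rw [norm_mul, norm_mul, Complex.norm_real, Real.norm_eq_abs]
  have h1 := hw d hd
  have h2 := χ.norm_le_one (d : ZMod q)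
  have h3 := χ.norm_sum_le_of_ne_one hχ (X / d)
  calc _ ≤ 1 * (1 * (2 * √q * (1 + Real.log q))) := by gcongr
    _ = _ := by ring

/-! ### Cauchy–Schwarz and the sum over pairs. -/

theorem norm_jacobiSym_le_one (n : ℤ) (m : ℕ) : ‖((J(n | m) : ℤ) : ℂ)‖ ≤ 1 := by
  rcases jacobiSym.trichotomy n m with h | h | h <;> simp [h]

theorem norm_sum_mul_star_le {a : ℕ → ℂ} (ha : ∀ n, Even n → a n = 0) (ha1 : ∀ n, ‖a n‖ ≤ 1)
    {F : ℕ → ℝ} {n₀ m₀ : ℕ} {A B : ℝ} (hF : ∀ m ∈ Icc 1 m₀, 0 ≤ F m)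
    (hA : ∑ m ∈ Icc 1 m₀, F m ≤ A) (hA0 : 0 ≤ A) (hB0 : 0 ≤ B)
    (hB : ∀ n : ℕ, n ≤ n₀ ^ 2 → Odd n → ¬ IsSquare n →
      ‖∑ m ∈ Icc 1 m₀ with Odd m, (F m : ℂ) * (J((n : ℤ) | m) : ℂ)‖ ≤ B) :
    ∑ m ∈ Icc 1 m₀ with Odd m, F m * ‖∑ n ∈ Icc 1 n₀, a n * (J((n : ℤ) | m) : ℂ)‖ ^ 2
      ≤ #{x ∈ Icc 1 n₀ ×ˢ Icc 1 n₀ | IsSquare (x.1 * x.2)} * A + n₀ ^ 2 * B := by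
  set T : ℕ → ℂ := fun m => ∑ n ∈ Icc 1 n₀, a n * (J((n : ℤ) | m) : ℂ) with hT
  have heq : ((∑ m ∈ Icc 1 m₀ with Odd m, F m * ‖T m‖ ^ 2 : ℝ) : ℂ) =
      ∑ x ∈ Icc 1 n₀ ×ˢ Icc 1 n₀, a x.1 * star (a x.2) *
        ∑ m ∈ Icc 1 m₀ with Odd m, (F m : ℂ) * (J(((x.1 * x.2 : ℕ) : ℤ) | m) : ℂ) := by
    simp_rw [mul_sum]
    rw [sum_comm, Complex.ofReal_sum]
    refine sum_congr rfl fun m _ => ?_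
    rw [Complex.ofReal_mul, Complex.ofReal_pow, ← Complex.mul_conj', hT]
    simp only [map_sum, map_mul, map_intCast]
    rw [sum_mul_sum, ← sum_product', mul_sum]
    refine sum_congr rfl fun x _ => ?_
    rw [Nat.cast_mul, jacobiSym.mul_left, Int.cast_mul, ← starRingEnd_apply]
    ring
  have hterm : ∀ x ∈ Icc 1 n₀ ×ˢ Icc 1 n₀, ‖a x.1 * star (a x.2) *
      ∑ m ∈ Icc 1 m₀ with Odd m, (F m : ℂ) * (J(((x.1 * x.2 : ℕ) : ℤ) | m) : ℂ)‖ ≤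
      (if IsSquare (x.1 * x.2) then A else 0) + B := by
    rintro ⟨u, v⟩ hx
    simp only [mem_product, mem_Icc] at hx ⊢
    have hrhs : 0 ≤ (if IsSquare (u * v) then A else 0) + B := by
      split_ifs <;> positivity
    by_cases hu : Even u
    · simpa [ha u hu] using hrhs
    by_cases hv : Even v
    · simpa [ha v hv] using hrhs
    rw [Nat.not_even_iff_odd] at hu hv
    have hbound : ‖∑ m ∈ Icc 1 m₀ with Odd m, (F m : ℂ) * (J(((u * v : ℕ) : ℤ) | m) : ℂ)‖ ≤
        (if IsSquare (u * v) then A else 0) + B := by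
      split_ifs with hs
      · refine le_trans (norm_sum_le _ _) ?_
        calc _ ≤ ∑ m ∈ Icc 1 m₀ with Odd m, F m := by
              refine sum_le_sum fun m hm => ?_
              have h0 := hF m (mem_filter.1 hm).1
              rw [norm_mul, Complex.norm_real, Real.norm_of_nonneg h0]
              exact mul_le_of_le_one_right h0 (norm_jacobiSym_le_one _ _)
          _ ≤ ∑ m ∈ Icc 1 m₀, F m :=
              sum_le_sum_of_subset_of_nonneg (filter_subset _ _) fun m hm _ => hF m hm
          _ ≤ A + B := by linarith
      · rw [zero_add]
        refine hB _ ?_ (hu.mul hv) hs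
        rw [sq]
        exact Nat.mul_le_mul hx.1.2 hx.2.2
    rw [norm_mul, norm_mul, norm_star]
    calc _ ≤ 1 * 1 * ((if IsSquare (u * v) then A else 0) + B) := by
          gcongr
          · exact ha1 u
          · exact ha1 v
      _ = _ := by ring
  have h0 : 0 ≤ ∑ m ∈ Icc 1 m₀ with Odd m, F m * ‖T m‖ ^ 2 := sum_nonneg fun m hm =>
    mul_nonneg (hF m (mem_filter.1 hm).1) (by positivity)
  have hnorm := congrArg norm heq
  rw [Complex.norm_real, Real.norm_of_nonneg h0] at hnorm
  rw [hnorm]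
  refine (norm_sum_le_of_le _ hterm).trans_eq ?_
  rw [sum_add_distrib, ← sum_filter, sum_const, sum_const, card_product, Nat.card_Icc,
    Nat.add_sub_cancel, nsmul_eq_mul, nsmul_eq_mul]
  push_cast
  ring

/-- Replacing `f` by `F` must precede Cauchy–Schwarz and the opening of the square: afterwards the
terms have signs and domination is no longer available. -/
theorem norm_sum_sum_jacobiSym_sq_le {a b : ℕ → ℂ} (ha : ∀ n, Even n → a n = 0)
    (hb : ∀ m, Even m → b m = 0) (ha1 : ∀ n, ‖a n‖ ≤ 1) (hb1 : ∀ m, ‖b m‖ ≤ 1)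
    {f F : ℕ → ℝ} {n₀ m₀ : ℕ} {A B : ℝ} (hfF : ∀ m ∈ Icc 1 m₀, 0 ≤ f m ∧ f m ≤ F m)
    (hA : ∑ m ∈ Icc 1 m₀, F m ≤ A) (hB0 : 0 ≤ B)
    (hB : ∀ n : ℕ, n ≤ n₀ ^ 2 → Odd n → ¬ IsSquare n →
      ‖∑ m ∈ Icc 1 m₀ with Odd m, (F m : ℂ) * (J((n : ℤ) | m) : ℂ)‖ ≤ B) :
    ‖∑ n ∈ Icc 1 n₀, ∑ m ∈ Icc 1 m₀, a n * b m * (f m : ℂ) * ((J((n : ℤ) | m) : ℤ) : ℂ)‖ ^ 2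
      ≤ A * (#{x ∈ Icc 1 n₀ ×ˢ Icc 1 n₀ | IsSquare (x.1 * x.2)} * A + n₀ ^ 2 * B) := by
  have hF : ∀ m ∈ Icc 1 m₀, 0 ≤ F m := fun m hm => (hfF m hm).1.trans (hfF m hm).2
  have hA0 : 0 ≤ A := (sum_nonneg hF).trans hA
  have hQ := norm_sum_mul_star_le ha ha1 hF hA hA0 hB0 hB
  set T : ℕ → ℂ := fun m => ∑ n ∈ Icc 1 n₀, a n * (J((n : ℤ) | m) : ℂ) with hT
  have hS : ‖∑ n ∈ Icc 1 n₀, ∑ m ∈ Icc 1 m₀,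
      a n * b m * (f m : ℂ) * ((J((n : ℤ) | m) : ℤ) : ℂ)‖
      ≤ ∑ m ∈ Icc 1 m₀ with Odd m, F m * ‖T m‖ := by
    rw [sum_comm, sum_filter]
    refine norm_sum_le_of_le _ fun m hm => ?_
    have h1 : ∑ n ∈ Icc 1 n₀, a n * b m * (f m : ℂ) * ((J((n : ℤ) | m) : ℤ) : ℂ)
        = b m * (f m : ℂ) * T m := by
      rw [hT, mul_sum]
      exact sum_congr rfl fun n _ => by ring
    rw [h1]
    split_ifs with hodd
    · obtain ⟨h2, h3⟩ := hfF m hm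
      rw [norm_mul, norm_mul, Complex.norm_real, Real.norm_of_nonneg h2]
      calc _ ≤ 1 * F m * ‖T m‖ := by
            gcongr
            exact hb1 m
        _ = _ := by ring
    · simp [hb m (Nat.not_odd_iff_even.1 hodd)]
  calc _ ≤ (∑ m ∈ Icc 1 m₀ with Odd m, F m * ‖T m‖) ^ 2 := by gcongr
    _ ≤ (∑ m ∈ Icc 1 m₀ with Odd m, F m) * ∑ m ∈ Icc 1 m₀ with Odd m, F m * ‖T m‖ ^ 2 := by
        refine sum_sq_le_sum_mul_sum_of_sq_le_mul _ (fun m hm => hF m (mem_filter.1 hm).1)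
          (fun m hm => mul_nonneg (hF m (mem_filter.1 hm).1) (by positivity)) fun m _ => ?_
        exact le_of_eq (by ring)
    _ ≤ _ := by
        refine mul_le_mul ?_ hQ (sum_nonneg fun m hm =>
          mul_nonneg (hF m (mem_filter.1 hm).1) (by positivity)) hA0
        exact (sum_le_sum_of_subset_of_nonneg (filter_subset _ _) fun m hm _ => hF m hm).trans hA

/-! ### Numerical estimates and assembly. -/

theorem rpow_mul_log_rpow_le {M β δ : ℝ} (hM : 2 ≤ M) (hβ0 : 0 ≤ β) (hβ1 : β ≤ 1)
    (hδ : δ ≤ 1 / 8) : (M ^ δ) ^ 4 * (Real.log M) ^ β ≤ 2 * M := by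
  have hM0 : 0 < M := by linarith
  have hs1 : 1 ≤ M ^ (1 / 2 : ℝ) := Real.one_le_rpow (by linarith) (by norm_num)
  have h1 : Real.log M ≤ 2 * M ^ (1 / 2 : ℝ) := by
    have := Real.log_le_rpow_div hM0.le (by norm_num : (0 : ℝ) < 1 / 2)
    linarith
  have h2 : (Real.log M) ^ β ≤ 2 * M ^ (1 / 2 : ℝ) := by
    calc (Real.log M) ^ β ≤ (2 * M ^ (1 / 2 : ℝ)) ^ β :=
          Real.rpow_le_rpow (Real.log_nonneg (by linarith)) h1 hβ0
      _ ≤ (2 * M ^ (1 / 2 : ℝ)) ^ (1 : ℝ) :=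
          Real.rpow_le_rpow_of_exponent_le (by linarith) hβ1
      _ = _ := Real.rpow_one _
  have h3 : (M ^ δ) ^ 4 ≤ M ^ (1 / 2 : ℝ) := by
    rw [← Real.rpow_mul_natCast hM0.le]
    refine Real.rpow_le_rpow_of_exponent_le (by linarith) ?_
    push_cast
    linarith
  have h4 : M ^ (1 / 2 : ℝ) * M ^ (1 / 2 : ℝ) = M := by
    rw [← Real.rpow_add hM0]
    norm_num
  calc _ ≤ M ^ (1 / 2 : ℝ) * (2 * M ^ (1 / 2 : ℝ)) := by
        refine mul_le_mul h3 h2 ?_ (by positivity)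
        exact Real.rpow_nonneg (Real.log_nonneg (by linarith)) _
    _ = 2 * M := by rw [mul_left_comm, h4]

/-- The numerical combination of the diagonal and off-diagonal bounds. -/
theorem mul_add_le_sq {C M N l P r s u p D : ℝ} (hC : 0 ≤ C) (hM : 0 ≤ M) (hN : 0 ≤ N)
    (hl : 1 / 2 ≤ l) (hp : 0 < p) (hu : 0 ≤ u) (hr : r ^ 2 = N) (hr0 : 0 ≤ r)
    (hs : s ^ 2 = l) (hs0 : 0 ≤ s) (hP : p ^ 2 = P) (hD0 : 0 ≤ D)
    (hD : M * D ≤ u ^ 2) :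
    C * M / P * (3 * N * l * (C * M / P) + N ^ 2 * (D * (24 * N * l)))
      ≤ (5 * (C + 1) * (M * r * l / P + u * (N * r) * s / p)) ^ 2 := by
  subst hr hs hP
  have hx : 0 ≤ M * r * s ^ 2 / p ^ 2 := by positivity
  have hy : 0 ≤ u * (r ^ 2 * r) * s / p := by positivity
  have h1 : C * M / p ^ 2 * (3 * r ^ 2 * s ^ 2 * (C * M / p ^ 2)) ≤
      (5 * (C + 1)) ^ 2 * (M * r * s ^ 2 / p ^ 2) ^ 2 := by
    have e1 : C * M / p ^ 2 * (3 * r ^ 2 * s ^ 2 * (C * M / p ^ 2)) =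
        3 * C ^ 2 * (M * r * s / p ^ 2) ^ 2 := by ring
    have e2 : (5 * (C + 1)) ^ 2 * (M * r * s ^ 2 / p ^ 2) ^ 2 =
        (25 * (C + 1) ^ 2 * s ^ 2) * (M * r * s / p ^ 2) ^ 2 := by ring
    rw [e1, e2]
    refine mul_le_mul_of_nonneg_right ?_ (by positivity)
    -- The diagonal needs only `l ^ (1 / 2)`; the target has `l`, and `l ≥ 1 / 2` absorbs the
    -- difference.
    nlinarith [mul_le_mul_of_nonneg_left hl (by positivity : 0 ≤ 25 * (C + 1) ^ 2)]
  have h2 : C * M / p ^ 2 * ((r ^ 2) ^ 2 * (D * (24 * r ^ 2 * s ^ 2))) ≤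
      (5 * (C + 1)) ^ 2 * (u * (r ^ 2 * r) * s / p) ^ 2 := by
    have e1 : C * M / p ^ 2 * ((r ^ 2) ^ 2 * (D * (24 * r ^ 2 * s ^ 2))) =
        24 * C * (M * D) * ((r ^ 2 * r) * s / p) ^ 2 := by ring
    have e2 : (5 * (C + 1)) ^ 2 * (u * (r ^ 2 * r) * s / p) ^ 2 =
        25 * (C + 1) ^ 2 * u ^ 2 * ((r ^ 2 * r) * s / p) ^ 2 := by ring
    rw [e1, e2]
    refine mul_le_mul_of_nonneg_right ?_ (by positivity)
    exact mul_le_mul (by nlinarith) hD (by positivity) (by positivity)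
  rw [mul_add, mul_pow, add_sq, mul_add, mul_add]
  have h3 : 0 ≤ (5 * (C + 1)) ^ 2 *
      (2 * (M * r * s ^ 2 / p ^ 2) * (u * (r ^ 2 * r) * s / p)) := by positivity
  linarith

theorem theorem1p1 (ε : ℝ) (hε : 0 < ε) (K : ℝ) :
    ∃ C : ℝ, 0 < C ∧
      ∀ (f : ArithmeticFunction ℝ) (α : ℝ),
        f.IsMultiplicative →
        (∀ p : ℕ, p.Prime → 0 ≤ f p ∧ f p ≤ 1) →
        (∀ p m : ℕ, p.Prime → 2 ≤ m → 0 ≤ f (p ^ m) ∧ f (p ^ m) ≤ f p) →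
        0 < α → α ≤ 1 →
        (∀ X : ℝ, 2 ≤ X → |primeSum f X - α * Real.log (Real.log X)| ≤ K) →
        ∀ (M N : ℝ), 2 ≤ M → 2 ≤ N →
        ∀ (a b : ℕ → ℂ),
          (∀ n : ℕ, Even n → a n = 0) → (∀ m : ℕ, Even m → b m = 0) →
          (∀ n : ℕ, ‖a n‖ ≤ 1) → (∀ m : ℕ, ‖b m‖ ≤ 1) →
          ‖bilinearJacobiSum f a b N M‖ ≤
            C * (M * N ^ (1 / 2 : ℝ) * Real.log N / (Real.log M) ^ (1 - α)
              + M ^ (1 / 2 + ε) * N ^ (3 / 2 : ℝ) * (Real.log N) ^ (1 / 2 : ℝ)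
                / (Real.log M) ^ ((1 - α) / 2)) := by
  -- The sieve level is `M ^ (4 * δ)`: `ε / 2` makes `M * D` at most `(M ^ (1 / 2 + ε)) ^ 2`, and `1
  -- / 8` lets the rounding error `#𝒟` be absorbed in `2 * M / P`, the source of the `+ 2` in `C₁`.
  set δ : ℝ := min (ε / 2) (1 / 8) with hδ
  have hδ0 : 0 < δ := lt_min (by linarith) (by norm_num)
  have hδ8 : δ ≤ 1 / 8 := min_le_right _ _
  have hδε : δ ≤ ε / 2 := min_le_left _ _
  set C₁ : ℝ := Real.exp (Real.exp 8) * (Real.exp (1 + |K|) / δ) + 2 with hC₁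
  have hC₁0 : 0 < C₁ := by positivity
  refine ⟨5 * (C₁ + 1), by positivity, ?_⟩
  intro f α hf h1 h2 hα0 hα1 hK M N hM hN a b ha hb ha1 hb1
  have hM0 : 0 < M := by linarith
  have hN0 : 0 < N := by linarith
  have hL : 0 < Real.log M := Real.log_pos (by linarith)
  have hl2 : 1 / 2 ≤ Real.log N :=
    (by linarith [Real.log_two_gt_d9] : (1 : ℝ) / 2 ≤ Real.log 2).trans
      (Real.log_le_log (by norm_num) hN)
  have hz : 1 ≤ M ^ δ := Real.one_le_rpow (by linarith) hδ0.le
  set P := (Real.log M) ^ (1 - α) with hPdef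
  have hP : 0 < P := Real.rpow_pos_of_pos hL _
  obtain ⟨𝒟, w, h𝒟, hw, hmaj, hmain⟩ := exists_sieve_majorant hf h1 h2 hz
  have h𝒟0 : ∀ d ∈ 𝒟, 0 < d := fun d hd => (h𝒟 d hd).1
  set D := (M ^ δ) ^ 4 with hDdef
  have hcard : (#𝒟 : ℝ) ≤ D := by
    have hsub : 𝒟 ⊆ Icc 1 ⌊D⌋₊ := fun d hd =>
      mem_Icc.2 ⟨h𝒟0 d hd, Nat.le_floor (h𝒟 d hd).2⟩
    have := card_le_card hsub
    rw [Nat.card_Icc, Nat.add_sub_cancel] at this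
    exact (Nat.cast_le.2 this).trans (Nat.floor_le (by positivity))
  have hDP : D ≤ 2 * M / P := by
    rw [le_div_iff₀ hP]
    exact rpow_mul_log_rpow_le hM (by linarith) (by linarith) hδ8
  set F : ℕ → ℝ := fun m => ∑ d ∈ 𝒟, if d ∣ m then w d else 0 with hF
  set n₀ := ⌊N⌋₊ with hn₀
  set m₀ := ⌊M⌋₊ with hm₀
  have hm₀M : (m₀ : ℝ) ≤ M := Nat.floor_le hM0.le
  have hn₀N : (n₀ : ℝ) ≤ N := Nat.floor_le hN0.le
  have hfF : ∀ m ∈ Icc 1 m₀, 0 ≤ f m ∧ f m ≤ F m := fun m hm => by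
    have hm0 : m ≠ 0 := by rw [mem_Icc] at hm; lia
    exact ⟨(map_le_prod_primeFactors hf h1 h2 hm0).1, hmaj m hm0⟩
  have hA : ∑ m ∈ Icc 1 m₀, F m ≤ C₁ * M / P := by
    have hexp := exp_neg_sum_primesLE_le h1 hα0 hα1 hK hδ0 (by linarith) hM
    have hw' : ∑ d ∈ 𝒟, w d / d ≤
        Real.exp (Real.exp 8) * (Real.exp (1 + |K|) / δ / P) :=
      hmain.trans (mul_le_mul_of_nonneg_left hexp (Real.exp_pos _).le)
    have hpos : 0 ≤ Real.exp (Real.exp 8) * (Real.exp (1 + |K|) / δ / P) := by positivity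
    calc ∑ m ∈ Icc 1 m₀, F m ≤ m₀ * ∑ d ∈ 𝒟, w d / d + #𝒟 := sum_Icc_sum_dvd_le h𝒟0 hw m₀
      _ ≤ M * (Real.exp (Real.exp 8) * (Real.exp (1 + |K|) / δ / P)) + 2 * M / P := by
          refine add_le_add ?_ (hcard.trans hDP)
          exact (mul_le_mul_of_nonneg_left hw' (Nat.cast_nonneg _)).trans
            (mul_le_mul_of_nonneg_right hm₀M hpos)
      _ = C₁ * M / P := by rw [hC₁]; ring
  have hB : ∀ n : ℕ, n ≤ n₀ ^ 2 → Odd n → ¬ IsSquare n →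
      ‖∑ m ∈ Icc 1 m₀ with Odd m, (F m : ℂ) * (J((n : ℤ) | m) : ℂ)‖
        ≤ D * (24 * N * Real.log N) := by
    intro n hn hodd hsq
    have : NeZero n := ⟨hodd.pos.ne'⟩
    have h := norm_sum_sum_dvd_mul_char_le (jacobiChar_ne_one hodd hsq) h𝒟0 hw m₀
    simp_rw [jacobiChar_natCast, mul_ite, mul_zero] at h
    rw [← sum_filter] at h
    refine h.trans (mul_le_mul hcard ?_ (by positivity) (by positivity))
    have hn2 : (n : ℝ) ≤ N ^ 2 := by
      calc (n : ℝ) ≤ ((n₀ ^ 2 : ℕ) : ℝ) := by exact_mod_cast hn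
        _ = (n₀ : ℝ) ^ 2 := by push_cast; rfl
        _ ≤ N ^ 2 := by gcongr
    have hn0 : (0 : ℝ) < n := by exact_mod_cast hodd.pos
    -- The modulus `4 * n` is at most `(2 * N) ^ 2`; with `1 ≤ 2 * log N` this produces `24 = 2 * 2
    -- * 6`.
    have hq : ((4 * n : ℕ) : ℝ) ≤ (2 * N) ^ 2 := by push_cast; linarith
    have hsqrt : √((4 * n : ℕ) : ℝ) ≤ 2 * N := Real.sqrt_le_iff.2 ⟨by positivity, hq⟩
    have hlog : Real.log ((4 * n : ℕ) : ℝ) ≤ 4 * Real.log N := by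
      calc Real.log ((4 * n : ℕ) : ℝ) ≤ Real.log ((2 * N) ^ 2) :=
            Real.log_le_log (by push_cast; positivity) hq
        _ = 2 * (Real.log 2 + Real.log N) := by
            rw [Real.log_pow, Real.log_mul (by norm_num) hN0.ne']
            norm_num
        _ ≤ 4 * Real.log N := by
            linarith [Real.log_le_log (by norm_num) hN]
    calc 2 * √((4 * n : ℕ) : ℝ) * (1 + Real.log ((4 * n : ℕ) : ℝ))
        ≤ 2 * (2 * N) * (6 * Real.log N) := by
          refine mul_le_mul (by linarith) (by linarith) ?_ (by positivity)
          have := Real.log_natCast_nonneg (4 * n)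
          linarith
      _ = 24 * N * Real.log N := by ring
  have hsq : (#{x ∈ Icc 1 n₀ ×ˢ Icc 1 n₀ | IsSquare (x.1 * x.2)} : ℝ) ≤ 3 * N * Real.log N := by
    have hn₀1 : (0 : ℝ) < n₀ := by exact_mod_cast Nat.floor_pos.2 (by linarith : 1 ≤ N)
    calc _ ≤ (n₀ : ℝ) * (1 + Real.log n₀) := card_pairs_isSquare_le n₀
      _ ≤ N * (3 * Real.log N) := by
          have := Real.log_le_log hn₀1 hn₀N
          have h0 := Real.log_natCast_nonneg n₀
          exact mul_le_mul hn₀N (by linarith) (by linarith) hN0.le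
      _ = _ := by ring
  have hl0 : 0 ≤ Real.log N := by linarith
  have hD0 : 0 ≤ D := by positivity
  have hA0 : 0 ≤ C₁ * M / P := by positivity
  have hfinal := norm_sum_sum_jacobiSym_sq_le ha hb ha1 hb1 hfF hA
    (by positivity : 0 ≤ D * (24 * N * Real.log N)) hB
  have hMD : M * D ≤ (M ^ (1 / 2 + ε)) ^ 2 := by
    rw [hDdef, ← Real.rpow_mul_natCast hM0.le, ← Real.rpow_mul_natCast hM0.le]
    calc M * M ^ (δ * (4 : ℕ)) = M ^ (1 + δ * (4 : ℕ)) := by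
          rw [Real.rpow_add hM0, Real.rpow_one]
      _ ≤ _ := by
          refine Real.rpow_le_rpow_of_exponent_le (by linarith) ?_
          push_cast
          linarith
  have hhalf : ∀ x : ℝ, 0 ≤ x → (x ^ (1 / 2 : ℝ)) ^ 2 = x := fun x hx => by
    rw [← Real.rpow_mul_natCast hx]
    norm_num
  have hp : ((Real.log M) ^ ((1 - α) / 2)) ^ 2 = P := by
    rw [hPdef, ← Real.rpow_mul_natCast hL.le]
    congr 1
    push_cast
    ring
  have hN32 : N ^ (3 / 2 : ℝ) = N * N ^ (1 / 2 : ℝ) := by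
    rw [show (3 / 2 : ℝ) = 1 + 1 / 2 by norm_num, Real.rpow_add hN0, Real.rpow_one]
  refine abs_le_of_sq_le_sq' ?_ (by positivity) |>.2
  rw [hN32]
  refine hfinal.trans (le_trans ?_ (mul_add_le_sq (D := D) hC₁0.le hM0.le hN0.le hl2
    (Real.rpow_pos_of_pos hL _) (Real.rpow_nonneg hM0.le _) (hhalf N hN0.le)
    (Real.rpow_nonneg hN0.le _) (hhalf _ hl0) (Real.rpow_nonneg hl0 _) hp hD0 hMD))
  gcongr
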